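/- Let $n\ge 2$ and let $M\subset\mathbb{R}^{n+1}$ be a complete, non-compact, embedded, orientable hypersurface of class $C^3$ with finitely many regular ends: there is a compact $K\subset M$ such that $M\setminus K$ has finitely many connected components (the ends), and each of them is, in Euclidean coordinates $(x,t)\in\mathbb{R}^n\times\mathbb{R}$ adapted to some hyperplane $\Pi=\{t=0\}$, the graph of a function over the exterior of a bounded region of $\Pi$ that has a limit in $[-\infty,\infty]$ as $|x|\to\infty$. Let $N$ be an end, the graph of $f$ over $\mathbb{R}^n\setminus\Omega$ with $\Omega$ bounded, and let $g_{ij}=\delta_{ij}+f_if_j$ be the induced metric of $N$ in the graph coordinates $x$, with scalar curvature $R$. Write $f_i=\partial_i f$, $f_{ij}=\partial_i\partial_j f$, $S_r=\{|x|=r\}$, $d\sigma$ for the standard volume measure of $S_r$, and $\omega_{n-1}=\mathrm{vol}(\mathbb{S}^{n-1})$. Suppose that $R\in L^1(N)$ (for the Riemannian volume of $N$), and that $f$ is differentiable for $|x|$ large with $|Df(x)|=O(1)$ as $|x|\to\infty$. Then the graphical mass $$m=\frac{1}{2(n-1)\omega_{n-1}}\lim_{r\to\infty}\int_{S_r}\frac{1}{1+|Df|^2}\sum_{i,j}(f_{ii}f_j-f_{ij}f_i)\frac{x^j}{|x|}\,d\sigma$$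 is finite, that is, the limit exists in $\mathbb{R}$. If in addition $n\ge3$, $|Df|^2=O_2(|x|^{-q})$ for some $q>\frac{n-2}{2}$ (that is, $|Df|^2=O(|x|^{-q})$, its first partial derivatives are $O(|x|^{-q-1})$ and its second ones are $O(|x|^{-q-2})$), and $|Df|^2|D^2f|=o(|x|^{1-n})$ as $|x|\to\infty$, then the limit defining the ADM mass in the graph coordinates also exists, and $$m=\frac{1}{2(n-1)\omega_{n-1}}\lim_{r\to\infty}\int_{S_r}\sum_{i,j}\Big(\frac{\partial g_{ij}}{\partial x^i}-\frac{\partial g_{ii}}{\partial x^j}\Big)\tau^j\,d\sigma_g,$$ where $\tau=\tau^j\partial_j$ is the outward unit normal of $S_r$ with respect to $g$ and $d\sigma_g$ is the volume measure that $g$ induces on $S_r$. -/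

import Mathlib

open Set Filter Topology MeasureTheory Asymptotics Bornology
open scoped ENNReal

noncomputable section

namespace HypersurfaceMass

/-- Euclidean space `ℝⁿ`. -/
abbrev E (n : ℕ) : Type := EuclideanSpace ℝ (Fin n)

/-! ### Hypersurfaces with finitely many regular ends -/

/-- `M ⊆ ℝⁿ⁺¹` is an embedded hypersurface of class `C^k`: locally it is the zero set of a `C^k`
function without critical points. -/
def IsEmbeddedHypersurface {n : ℕ} (k : ℕ) (M : Set (E (n + 1))) : Prop :=
  ∀ p ∈ M, ∃ (V : Set (E (n + 1))) (ρ : E (n + 1) → ℝ),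
    IsOpen V ∧ p ∈ V ∧ ContDiffOn ℝ k ρ V ∧ (∀ z ∈ V, fderiv ℝ ρ z ≠ 0) ∧
      M ∩ V = {z ∈ V | ρ z = 0}

/-- `M` carries a continuous unit normal vector field. -/
def IsOrientable {n : ℕ} (M : Set (E (n + 1))) : Prop :=
  ∃ ν : E (n + 1) → E (n + 1), ContinuousOn ν M ∧
    ∀ p ∈ M, ‖ν p‖ = 1 ∧ ∀ v ∈ tangentConeAt ℝ M p, inner ℝ (ν p) v = 0

/-- The intrinsic distance of `M`: the infimum of the lengths of the curves in `M` from `p` to `q`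
(it is `⊤` if there is no such curve of finite length). -/
def intrinsicEDist {n : ℕ} (M : Set (E (n + 1))) (p q : E (n + 1)) : ℝ≥0∞ :=
  ⨅ (γ : ℝ → E (n + 1))
    (_ : ContinuousOn γ (Icc 0 1) ∧ MapsTo γ (Icc 0 1) M ∧ γ 0 = p ∧ γ 1 = q),
    eVariationOn γ (Icc 0 1)

/-- `M` is complete for its intrinsic distance. -/
def IsIntrinsicallyComplete {n : ℕ} (M : Set (E (n + 1))) : Prop :=
  ∀ u : ℕ → E (n + 1), (∀ m, u m ∈ M) →
    (∀ ε : ℝ≥0∞, 0 < ε → ∃ m₀, ∀ m ≥ m₀, ∀ l ≥ m₀, intrinsicEDist M (u m) (u l) < ε) →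
    ∃ p ∈ M, Tendsto (fun m => intrinsicEDist M (u m) p) atTop (𝓝 0)

/-- Let `T` be Euclidean coordinates `(x, t) ∈ ℝⁿ × ℝ` of `ℝⁿ⁺¹`; they single out the affine
hyperplane `Π = {t = 0}` and Euclidean coordinates `x` on it. `graphMap T f` is the
parametrization `x ↦ (x, f x)` of the graph of `f` over `Π`. -/
def graphMap {n : ℕ} (T : E (n + 1) ≃ᵃⁱ[ℝ] WithLp 2 (E n × ℝ)) (f : E n → ℝ) (x : E n) :
    E (n + 1) :=
  T.symm (WithLp.toLp 2 (x, f x))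

/-- `N` is the graph of `f` over the exterior of the bounded region `Ω` of the hyperplane
determined by `T`, and `f` has a limit, finite or `±∞`, at infinity. -/
structure IsRegularEnd {n : ℕ} (N : Set (E (n + 1)))
    (T : E (n + 1) ≃ᵃⁱ[ℝ] WithLp 2 (E n × ℝ)) (Ω : Set (E n)) (f : E n → ℝ) : Prop where
  isBounded : IsBounded Ω
  eq_graph : N = graphMap T f '' Ωᶜ
  exists_limit : ∃ a : EReal, Tendsto (fun x => (f x : EReal)) (cobounded (E n)) (𝓝 a)

/-- The connected components of `M \ K`. -/
def ends {n : ℕ} (M K : Set (E (n + 1))) : Set (Set (E (n + 1))) :=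
  {N | ∃ p ∈ M \ K, N = connectedComponentIn (M \ K) p}

/-- `M` is a complete `C^k` hypersurface of finitely many regular ends, and `K` is a compact
subset whose complement in `M` is the union of the ends. -/
structure IsHypersurfaceOfRegularEnds {n : ℕ} (k : ℕ) (M K : Set (E (n + 1))) : Prop where
  embedded : IsEmbeddedHypersurface k M
  orientable : IsOrientable M
  complete : IsIntrinsicallyComplete M
  not_compact : ¬ IsCompact M
  compact_core : IsCompact K
  core_subset : K ⊆ M
  finite_ends : (ends M K).Finite
  regular_ends : ∀ N ∈ ends M K, ∃ T Ω f, IsRegularEnd N T Ω f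

/-! ### Riemannian geometry in a coordinate chart -/

/-- The partial derivative `∂u/∂xⁱ`. -/
def pd {n : ℕ} (i : Fin n) (u : E n → ℝ) (x : E n) : ℝ :=
  fderiv ℝ u x (EuclideanSpace.single i 1)

/-- The metric `gᵢⱼ = ⟨∂ᵢX, ∂ⱼX⟩` induced on a parametrized hypersurface `X`. -/
def inducedMetric {n : ℕ} (X : E n → E (n + 1)) (x : E n) : Matrix (Fin n) (Fin n) ℝ :=
  Matrix.of fun i j =>
    inner ℝ (fderiv ℝ X x (EuclideanSpace.single i 1)) (fderiv ℝ X x (EuclideanSpace.single j 1))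

/-- The Christoffel symbol `Γᵏᵢⱼ` of the metric `g`. -/
def christoffel {n : ℕ} (g : E n → Matrix (Fin n) (Fin n) ℝ) (k i j : Fin n) (x : E n) : ℝ :=
  (1 / 2) * ∑ l, (g x)⁻¹ k l *
    (pd i (fun y => g y j l) x + pd j (fun y => g y i l) x - pd l (fun y => g y i j) x)

/-- The Ricci curvature `Rᵢⱼ` of the metric `g`. -/
def ricci {n : ℕ} (g : E n → Matrix (Fin n) (Fin n) ℝ) (i j : Fin n) (x : E n) : ℝ :=
  ∑ k, (pd k (christoffel g k i j) x - pd j (christoffel g k i k) x +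
    ∑ l, (christoffel g k k l x * christoffel g l i j x -
      christoffel g k j l x * christoffel g l i k x))

/-- The scalar curvature of the metric `g`. -/
def scalarCurvature {n : ℕ} (g : E n → Matrix (Fin n) (Fin n) ℝ) (x : E n) : ℝ :=
  ∑ i, ∑ j, (g x)⁻¹ i j * ricci g i j x

/-- The Riemannian volume measure of `g`, with density `√det g` in the chart. -/
def riemannianVolume {n : ℕ} (g : E n → Matrix (Fin n) (Fin n) ℝ) : Measure (E n) :=
  volume.withDensity fun x => ENNReal.ofReal (Real.sqrt (g x).det)

/-! ### The graphical mass -/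

/-- `∫_{S_r} φ dσ` for the standard volume measure of the sphere `S_r = {|x| = r}` of `ℝⁿ`. -/
def sphereIntegral {n : ℕ} (r : ℝ) (φ : E n → ℝ) : ℝ :=
  r ^ (n - 1) * ∫ ω : Metric.sphere (0 : E n) 1, φ (r • (ω : E n)) ∂(volume : Measure (E n)).toSphere

/-- The volume `ω_{n-1}` of the unit sphere of `ℝⁿ`. -/
def sphereVolume (n : ℕ) : ℝ :=
  (volume : Measure (E n)).toSphere.real univ

/-- `|Df|²`. -/
def gradSq {n : ℕ} (f : E n → ℝ) (x : E n) : ℝ :=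
  ∑ i, pd i f x ^ 2

/-- `|D²f|`. -/
def hessNorm {n : ℕ} (f : E n → ℝ) (x : E n) : ℝ :=
  Real.sqrt (∑ i, ∑ j, pd i (pd j f) x ^ 2)

/-- The integrand `(1 + |Df|²)⁻¹ ∑ᵢⱼ (fᵢᵢ fⱼ - fᵢⱼ fᵢ) xʲ / |x|`. -/
def massIntegrand {n : ℕ} (f : E n → ℝ) (x : E n) : ℝ :=
  1 / (1 + gradSq f x) *
    ∑ i, ∑ j, (pd i (pd i f) x * pd j f x - pd i (pd j f) x * pd i f x) * (x j / ‖x‖)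

/-- The graph of `f` has a mass: the limit defining it exists and is the real number `m`. -/
def HasGraphicalMass {n : ℕ} (f : E n → ℝ) (m : ℝ) : Prop :=
  Tendsto (fun r : ℝ =>
      1 / (2 * ((n : ℝ) - 1) * sphereVolume n) * sphereIntegral r (massIntegrand f))
    atTop (𝓝 m)

/-! ### The ADM mass -/

/-- The outward unit normal, with respect to `g`, of the sphere `{|y| = r}` through `x`: the
`g`-gradient `(∑ₖ gʲᵏ xₖ)ⱼ / |x|` of `|y|`, divided by its `g`-length. -/
def unitNormal {n : ℕ} (g : E n → Matrix (Fin n) (Fin n) ℝ) (x : E n) (j : Fin n) : ℝ :=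
  (∑ k, (g x)⁻¹ j k * x k) / Real.sqrt (∑ k, ∑ l, (g x)⁻¹ k l * x k * x l)

/-- The density, with respect to the standard measure of the sphere `{|y| = r}` through `x`, of the
volume measure that `g` induces on this sphere: the root of the Gram determinant, for `g`, of an
orthonormal basis of the tangent space `xᗮ` of the sphere. -/
def sphereDensity {n : ℕ} (g : E n → Matrix (Fin n) (Fin n) ℝ) (x : E n) : ℝ :=
  let b := stdOrthonormalBasis ℝ (Submodule.span ℝ {x})ᗮ
  Real.sqrt (Matrix.det (Matrix.of fun s t =>
    ∑ i, ∑ j, g x i j * (b s : E n) i * (b t : E n) j))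

/-- The integrand `∑ᵢⱼ (∂ᵢgᵢⱼ - ∂ⱼgᵢᵢ) τʲ dσ_g / dσ`. -/
def admIntegrand {n : ℕ} (g : E n → Matrix (Fin n) (Fin n) ℝ) (x : E n) : ℝ :=
  (∑ i, ∑ j, (pd i (fun y => g y i j) x - pd j (fun y => g y i i) x) * unitNormal g x j) *
    sphereDensity g x

/-- The limit that defines the ADM mass of `g` in the given chart exists and is equal to `m`. -/
def HasADMMass {n : ℕ} (g : E n → Matrix (Fin n) (Fin n) ℝ) (m : ℝ) : Prop :=
  Tendsto (fun r : ℝ =>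
      1 / (2 * ((n : ℝ) - 1) * sphereVolume n) * sphereIntegral r (admIntegrand g))
    atTop (𝓝 m)

/-- `u = O₂(|x|^{-q})` as `|x| → ∞`: the first and second derivatives decay one and two orders
faster than `u`. -/
def IsBigOTwo {n : ℕ} (u : E n → ℝ) (q : ℝ) : Prop :=
  (u =O[cobounded (E n)] fun x => ‖x‖ ^ (-q)) ∧
  (∀ i, pd i u =O[cobounded (E n)] fun x => ‖x‖ ^ (-q - 1)) ∧
  ∀ i j, pd i (pd j u) =O[cobounded (E n)] fun x => ‖x‖ ^ (-q - 2)

end HypersurfaceMass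

end

open HypersurfaceMass

noncomputable section

namespace HypersurfaceMass

/-! Regularity comes from the hypersurface. The graph of `f` lies in a regular level set of a `C³`
function, and differentiability of `f` rules out a vertical tangent line, so the implicit function
theorem makes `f` of class `C³` far out (`IsRegularEnd.exists_contDiffAt`).

The core is that the scalar curvature of the graph metric `δ + Df ⊗ Df` is the Euclidean divergence
of `massField`, the field whose outward flux through `S_r` is the integral defining the mass
(`scalarCurvature_eq_sum_pd_massField`). Since `det g = 1 + |Df|² ≥ 1`, integrability for the
Riemannian volume implies Lebesgue integrability. The derivative of the flux in `r` is the integral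
of the divergence over `S_r` (`deriv_flux`), hence integrable at infinity, and the flux converges
(`exists_tendsto_flux`).

For the ADM mass, `∑ᵢ (∂ᵢgᵢⱼ - ∂ⱼgᵢᵢ) = ∑ᵢ (fᵢᵢfⱼ - fᵢⱼfᵢ)`, so the two integrands differ only in
the weight multiplying this expression. The weights agree up to `O(|Df|²)`, so the difference is
`O(|Df| · |Df|²|D²f|) = o(|x|^{1-n})`, and its integral over `S_r` tends to zero
(`admIntegrand_graphMap`, `abs_massDefect_le`). -/

/-! ### Regularity of the function defining an end -/

/-- A differentiable function whose graph is contained in a regular level set of a `C^k` function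
is of class `C^k`. -/
lemma contDiffAt_of_graph_subset_level {X : Type*} [NormedAddCommGroup X] [NormedSpace ℝ X]
    [CompleteSpace X] {k : WithTop ℕ∞} (hk : k ≠ 0) {G : X × ℝ → ℝ} {f : X → ℝ} {x : X}
    (hG : ContDiffAt ℝ k G (x, f x)) (hG' : fderiv ℝ G (x, f x) ≠ 0)
    (hf : DifferentiableAt ℝ f x) (h : ∀ᶠ y in 𝓝 x, G (y, f y) = 0) : ContDiffAt ℝ k f x := by
  set L := fderiv ℝ G (x, f x) with hL
  have hzero : ∀ v, L (v, fderiv ℝ f x v) = 0 := by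
    intro v
    have h1 : HasFDerivAt (fun y => G (y, f y))
        (L.comp ((ContinuousLinearMap.id ℝ X).prod (fderiv ℝ f x))) x :=
      HasFDerivAt.comp x (g := G) (f := fun y => (y, f y))
        (hG.differentiableAt hk).hasFDerivAt ((hasFDerivAt_id x).prodMk hf.hasFDerivAt)
    have h2 : HasFDerivAt (fun y => G (y, f y)) (0 : X →L[ℝ] ℝ) x :=
      (hasFDerivAt_const (0 : ℝ) x).congr_of_eventuallyEq h
    simpa using DFunLike.congr_fun (h1.unique h2) v
  -- The kernel of `L` contains the tangent space of the graph; if it also contained the vertical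
  -- direction, `L` would vanish.
  have hc : L (0, 1) ≠ 0 := by
    intro h0
    refine hG' (ContinuousLinearMap.ext fun ⟨v, t⟩ => ?_)
    have : ((v, t) : X × ℝ) = (v, fderiv ℝ f x v) + (t - fderiv ℝ f x v) • ((0 : X), (1 : ℝ)) := by
      simp
    rw [this, map_add, map_smul, hzero, h0]
    simp
  have hinv : (L ∘L ContinuousLinearMap.inr ℝ X ℝ).IsInvertible := by
    refine ⟨ContinuousLinearEquiv.unitsEquivAut ℝ (Units.mk0 _ hc), ?_⟩
    ext
    simp
  have h0 : G (x, f x) = 0 := h.self_of_nhds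
  have key := hG.eventually_apply_eq_iff_implicitFunction hk hinv
  have hcont : Tendsto (fun y => (y, f y)) (𝓝 x) (𝓝 (x, f x)) :=
    (continuousAt_id.prodMk hf.continuousAt)
  refine (hG.contDiffAt_implicitFunction hk hinv).congr_of_eventuallyEq ?_
  -- Continuity keeps `(y, f y)` in the neighbourhood where the level set is the graph of the
  -- implicit function.
  filter_upwards [hcont.eventually key, h] with y hy hy0
  exact (hy.1 (hy0.trans h0.symm)).symm

lemma graphMap_apply {n : ℕ} (T : E (n + 1) ≃ᵃⁱ[ℝ] WithLp 2 (E n × ℝ)) (f : E n → ℝ) (x : E n) :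
    graphMap T f x = T.symm.linearIsometryEquiv
      ((WithLp.prodContinuousLinearEquiv 2 ℝ (E n) ℝ).symm (x, f x)) + T.symm 0 := by
  have := T.symm.map_vadd 0 ((WithLp.prodContinuousLinearEquiv 2 ℝ (E n) ℝ).symm (x, f x))
  simpa [graphMap] using this

/-- A differentiable function whose graph lies in a `C^k` hypersurface is of class `C^k`. -/
lemma contDiffAt_of_graphMap_mem {n : ℕ} {M : Set (E (n + 1))} {k : ℕ} (hk : k ≠ 0)
    (hM : IsEmbeddedHypersurface k M) (T : E (n + 1) ≃ᵃⁱ[ℝ] WithLp 2 (E n × ℝ)) {f : E n → ℝ}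
    {x : E n} (hf : DifferentiableAt ℝ f x) (h : ∀ᶠ y in 𝓝 x, graphMap T f y ∈ M) :
    ContDiffAt ℝ k f x := by
  let A : (E n × ℝ) ≃L[ℝ] E (n + 1) := (WithLp.prodContinuousLinearEquiv 2 ℝ (E n) ℝ).symm.trans
    T.symm.linearIsometryEquiv.toContinuousLinearEquiv
  have hA : ∀ y, graphMap T f y = A (y, f y) + T.symm 0 := graphMap_apply T f
  have hmem := h.self_of_nhds
  obtain ⟨V, ρ, hV, hpV, hρ, hρ', hMV⟩ := hM _ hmem
  have hVn : V ∈ 𝓝 (A (x, f x) + T.symm 0) := hA x ▸ hV.mem_nhds hpV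
  have hk' : (k : WithTop ℕ∞) ≠ 0 := by exact_mod_cast hk
  have hρx : ContDiffAt ℝ k ρ (A (x, f x) + T.symm 0) := hρ.contDiffAt hVn
  have hAd : HasFDerivAt (fun z => A z + T.symm 0) (A : (E n × ℝ) →L[ℝ] E (n + 1)) (x, f x) :=
    A.hasFDerivAt.add_const _
  have hAc : ContDiff ℝ k (fun z => A z + T.symm 0) := A.contDiff.add contDiff_const
  refine contDiffAt_of_graph_subset_level hk' (G := fun z => ρ (A z + T.symm 0))
    (ContDiffAt.comp (x, f x) (g := ρ) (f := fun z => A z + T.symm 0) hρx hAc.contDiffAt) ?_ hf ?_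
  · have h1 : HasFDerivAt (fun z => ρ (A z + T.symm 0))
        ((fderiv ℝ ρ (A (x, f x) + T.symm 0)).comp (A : (E n × ℝ) →L[ℝ] E (n + 1))) (x, f x) :=
      HasFDerivAt.comp (x, f x) (g := ρ) (f := fun z => A z + T.symm 0)
        (hρx.differentiableAt hk').hasFDerivAt hAd
    rw [h1.fderiv]
    intro h0
    refine hρ' _ (mem_of_mem_nhds hVn) (ContinuousLinearMap.ext fun v => ?_)
    simpa using DFunLike.congr_fun h0 (A.symm v)
  · have hcont : Tendsto (fun y => A (y, f y) + T.symm 0) (𝓝 x) (𝓝 (A (x, f x) + T.symm 0)) :=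
      hAd.continuousAt.tendsto.comp
        ((continuousAt_id.prodMk hf.continuousAt : ContinuousAt (fun y => (y, f y)) x).tendsto)
    filter_upwards [hcont hVn, h] with y hy hyM
    have : graphMap T f y ∈ M ∩ V := ⟨hyM, hA y ▸ hy⟩
    rw [hMV] at this
    simpa [hA y] using this.2

/-- The function defining a regular end is of class `C^k` wherever it is differentiable. -/
lemma IsRegularEnd.exists_contDiffAt {n k : ℕ} (hk : k ≠ 0) {M K N : Set (E (n + 1))}
    (hM : IsEmbeddedHypersurface k M) (hN : N ∈ ends M K)
    {T : E (n + 1) ≃ᵃⁱ[ℝ] WithLp 2 (E n × ℝ)} {Ω : Set (E n)} {f : E n → ℝ}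
    (hf : IsRegularEnd N T Ω f) (hdiff : ∀ᶠ x in cobounded (E n), DifferentiableAt ℝ f x) :
    ∃ r₀ : ℝ, 0 < r₀ ∧ ∀ x : E n, r₀ < ‖x‖ → x ∉ Ω ∧ ContDiffAt ℝ k f x := by
  have h1 : ∀ᶠ x in cobounded (E n), x ∉ Ω := hf.isBounded
  rw [← comap_norm_atTop, eventually_comap] at h1 hdiff
  obtain ⟨r₀, hr₀⟩ := eventually_atTop.1 (h1.and hdiff)
  refine ⟨max r₀ 1, by positivity, fun x hx => ⟨(hr₀ _ (le_of_max_le_left hx.le)).1 x rfl, ?_⟩⟩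
  refine contDiffAt_of_graphMap_mem hk hM T
    ((hr₀ _ (le_of_max_le_left hx.le)).2 x rfl) ?_
  filter_upwards [(isOpen_lt continuous_const continuous_norm).mem_nhds hx] with y hy
  have hyN : graphMap T f y ∈ N := by
    rw [hf.eq_graph]
    exact mem_image_of_mem _ ((hr₀ _ (le_of_max_le_left (le_of_lt hy))).1 y rfl)
  obtain ⟨p, -, rfl⟩ := hN
  exact (connectedComponentIn_subset _ _ hyN).1

variable {n : ℕ}

/-! ### Partial derivatives -/

lemma pd_congr {u v : E n → ℝ} {x : E n} (h : u =ᶠ[𝓝 x] v) (i : Fin n) : pd i u x = pd i v x := by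
  simp only [pd, h.fderiv_eq]

lemma pd_add {u v : E n → ℝ} {x : E n} (hu : DifferentiableAt ℝ u x) (hv : DifferentiableAt ℝ v x)
    (i : Fin n) : pd i (fun y => u y + v y) x = pd i u x + pd i v x := by
  simp [pd, fderiv_fun_add hu hv]

lemma pd_sub {u v : E n → ℝ} {x : E n} (hu : DifferentiableAt ℝ u x) (hv : DifferentiableAt ℝ v x)
    (i : Fin n) : pd i (fun y => u y - v y) x = pd i u x - pd i v x := by
  simp [pd, fderiv_fun_sub hu hv]

lemma pd_const (c : ℝ) (x : E n) (i : Fin n) : pd i (fun _ => c) x = 0 := by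
  simp [pd]

lemma pd_mul {u v : E n → ℝ} {x : E n} (hu : DifferentiableAt ℝ u x) (hv : DifferentiableAt ℝ v x)
    (i : Fin n) : pd i (fun y => u y * v y) x = u x * pd i v x + v x * pd i u x := by
  simp [pd, fderiv_fun_mul hu hv]

lemma pd_div {u v : E n → ℝ} {x : E n} (hu : DifferentiableAt ℝ u x) (hv : DifferentiableAt ℝ v x)
    (h0 : v x ≠ 0) (i : Fin n) :
    pd i (fun y => u y / v y) x = pd i u x / v x - u x * pd i v x / v x ^ 2 := by
  have h : HasFDerivAt (fun y => (v y)⁻¹) _ x :=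
    (hasDerivAt_inv h0).comp_hasFDerivAt x hv.hasFDerivAt
  simp only [div_eq_mul_inv]
  rw [pd_mul hu h.differentiableAt]
  simp only [pd, h.fderiv]
  simp
  ring

lemma pd_sum {ι : Type*} {s : Finset ι} {u : ι → E n → ℝ} {x : E n}
    (hu : ∀ k ∈ s, DifferentiableAt ℝ (u k) x) (i : Fin n) :
    pd i (fun y => ∑ k ∈ s, u k y) x = ∑ k ∈ s, pd i (u k) x := by
  simp [pd, fderiv_fun_sum hu]

lemma ContDiffAt.pd {u : E n → ℝ} {x : E n} {k : ℕ} (hu : ContDiffAt ℝ (k + 1 : ℕ) u x)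
    (i : Fin n) : ContDiffAt ℝ k (pd i u) x :=
  (hu.fderiv_right (m := k) (by norm_cast)).clm_apply contDiffAt_const

lemma pd_comm {u : E n → ℝ} {x : E n} (hu : ContDiffAt ℝ 2 u x) (i j : Fin n) :
    pd i (pd j u) x = pd j (pd i u) x := by
  have hd : DifferentiableAt ℝ (fderiv ℝ u) x :=
    (hu.fderiv_right (m := 1) (by norm_num)).differentiableAt (by norm_num)
  have h (a b : Fin n) : pd a (pd b u) x =
      fderiv ℝ (fderiv ℝ u) x (EuclideanSpace.single a 1) (EuclideanSpace.single b 1) := by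
    change fderiv ℝ (fun y => fderiv ℝ u y (EuclideanSpace.single b 1)) x _ = _
    simp [fderiv_clm_apply hd (differentiableAt_const _)]
  rw [h, h]
  exact (hu.isSymmSndFDerivAt (by simp)) _ _

/-! ### The induced metric of a graph -/

lemma inducedMetric_graphMap (T : E (n + 1) ≃ᵃⁱ[ℝ] WithLp 2 (E n × ℝ)) {f : E n → ℝ} {x : E n}
    (hf : DifferentiableAt ℝ f x) :
    inducedMetric (graphMap T f) x =
      1 + Matrix.vecMulVec (fun i => pd i f x) (fun i => pd i f x) := by
  have h : HasFDerivAt (graphMap T f)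
      ((T.symm.linearIsometryEquiv.toContinuousLinearEquiv :
          WithLp 2 (E n × ℝ) →L[ℝ] E (n + 1)).comp
        (((WithLp.prodContinuousLinearEquiv 2 ℝ (E n) ℝ).symm :
          (E n × ℝ) →L[ℝ] WithLp 2 (E n × ℝ)).comp
            ((ContinuousLinearMap.id ℝ (E n)).prod (fderiv ℝ f x)))) x := by
    have := ((T.symm.linearIsometryEquiv.toContinuousLinearEquiv.hasFDerivAt.comp x
      ((WithLp.prodContinuousLinearEquiv 2 ℝ (E n) ℝ).symm.hasFDerivAt.comp x
        ((hasFDerivAt_id x).prodMk hf.hasFDerivAt))).add_const (T.symm 0))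
    exact this.congr_of_eventuallyEq (Eventually.of_forall fun y => graphMap_apply T f y)
  ext i j
  simp only [inducedMetric, h.fderiv, Matrix.of_apply, Matrix.add_apply, Matrix.vecMulVec_apply]
  simp [WithLp.prod_inner_apply, pd, Matrix.one_apply, EuclideanSpace.inner_single_left, mul_comm]

lemma one_add_gradSq_pos (f : E n → ℝ) (x : E n) : 0 < 1 + gradSq f x := by
  have : 0 ≤ gradSq f x := Finset.sum_nonneg fun i _ => sq_nonneg _
  linarith

/-- Sherman–Morrison: `(a aᵀ)² = |a|² a aᵀ`. -/
lemma inv_one_add_vecMulVec_self (a : Fin n → ℝ) :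
    (1 + Matrix.vecMulVec a a)⁻¹ = 1 - (1 + ∑ i, a i ^ 2)⁻¹ • Matrix.vecMulVec a a := by
  have hW : (1 + ∑ i, a i ^ 2) ≠ 0 := by positivity
  apply Matrix.inv_eq_right_inv
  have h2 : Matrix.vecMulVec a a * Matrix.vecMulVec a a =
      (∑ i, a i ^ 2) • Matrix.vecMulVec a a := by
    ext i j
    simp only [Matrix.mul_apply, Matrix.vecMulVec_apply, Matrix.smul_apply, smul_eq_mul,
      Finset.sum_mul]
    exact Finset.sum_congr rfl fun k _ => by ring
  rw [mul_sub, mul_one, mul_smul_comm, add_mul, one_mul, h2]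
  ext i j
  simp only [Matrix.sub_apply, Matrix.add_apply, Matrix.smul_apply, smul_eq_mul]
  field_simp
  ring

/-- The index type is arbitrary because the lemma serves both the metric itself and its Gram matrix
on the tangent space of a sphere. -/
lemma det_one_add_vecMulVec_self {ι : Type*} [Fintype ι] [DecidableEq ι] (a : ι → ℝ) :
    (1 + Matrix.vecMulVec a a).det = 1 + ∑ i, a i ^ 2 := by
  rw [Matrix.vecMulVec_eq Unit, Matrix.det_one_add_replicateCol_mul_replicateRow]
  simp [dotProduct, sq]

lemma inducedMetric_graphMap_inv (T : E (n + 1) ≃ᵃⁱ[ℝ] WithLp 2 (E n × ℝ)) {f : E n → ℝ} {x : E n}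
    (hf : DifferentiableAt ℝ f x) (i j : Fin n) :
    (inducedMetric (graphMap T f) x)⁻¹ i j =
      (if i = j then 1 else 0) - pd i f x * pd j f x / (1 + gradSq f x) := by
  rw [inducedMetric_graphMap T hf, inv_one_add_vecMulVec_self]
  simp [Matrix.one_apply, Matrix.vecMulVec_apply, gradSq]
  ring

lemma pd_gradSq {f : E n → ℝ} {x : E n} (hf : ContDiffAt ℝ 2 f x) (i : Fin n) :
    pd i (fun y => 1 + gradSq f y) x = 2 * ∑ k, pd k f x * pd i (pd k f) x := by
  have hd (k : Fin n) : DifferentiableAt ℝ (pd k f) x :=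
    (ContDiffAt.pd (k := 1) hf k).differentiableAt (by norm_num)
  change pd i (fun y => 1 + ∑ k, pd k f y ^ 2) x = _
  simp only [sq]
  rw [pd_add (by fun_prop) (by fun_prop), pd_const, pd_sum (by fun_prop), zero_add, Finset.mul_sum]
  refine Finset.sum_congr rfl fun k _ => ?_
  rw [pd_mul (hd k) (hd k)]
  ring

lemma pd_inducedMetric_graphMap (T : E (n + 1) ≃ᵃⁱ[ℝ] WithLp 2 (E n × ℝ)) {f : E n → ℝ} {x : E n}
    (hf : ContDiffAt ℝ 2 f x) (l i j : Fin n) :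
    pd l (fun y => inducedMetric (graphMap T f) y i j) x =
      pd l (pd i f) x * pd j f x + pd i f x * pd l (pd j f) x := by
  have hd (k : Fin n) : DifferentiableAt ℝ (pd k f) x :=
    (ContDiffAt.pd (k := 1) hf k).differentiableAt (by norm_num)
  have h : (fun y => inducedMetric (graphMap T f) y i j) =ᶠ[𝓝 x]
      fun y => (if i = j then 1 else 0) + pd i f y * pd j f y := by
    filter_upwards [hf.eventually (by simp)] with y hy
    rw [inducedMetric_graphMap T (hy.differentiableAt (by norm_num))]
    simp [Matrix.vecMulVec_apply, Matrix.one_apply]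
  rw [pd_congr h, pd_add (by fun_prop) (by fun_prop), pd_const, pd_mul (hd i) (hd j)]
  ring

/-- The bracket of metric derivatives collapses to `2 fᵢⱼ fₗ`, and contracting `fₗ` with `g⁻¹` gives
`fₖ (1 - |Df|²/W) = fₖ/W`, where `W = 1 + |Df|²`. -/
lemma christoffel_graphMap (T : E (n + 1) ≃ᵃⁱ[ℝ] WithLp 2 (E n × ℝ)) {f : E n → ℝ} {x : E n}
    (hf : ContDiffAt ℝ 2 f x) (k i j : Fin n) :
    christoffel (inducedMetric (graphMap T f)) k i j x =
      pd i (pd j f) x * pd k f x / (1 + gradSq f x) := by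
  have hW := (one_add_gradSq_pos f x).ne'
  have h1 (l : Fin n) : (inducedMetric (graphMap T f) x)⁻¹ k l *
    (pd i (fun y => inducedMetric (graphMap T f) y j l) x +
      pd j (fun y => inducedMetric (graphMap T f) y i l) x -
      pd l (fun y => inducedMetric (graphMap T f) y i j) x) =
      (2 * pd i (pd j f) x) * (if k = l then pd l f x else 0) -
        (2 * pd i (pd j f) x * pd k f x / (1 + gradSq f x)) * pd l f x ^ 2 := by
    rw [inducedMetric_graphMap_inv T (hf.differentiableAt (by norm_num)),
      pd_inducedMetric_graphMap T hf, pd_inducedMetric_graphMap T hf,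
      pd_inducedMetric_graphMap T hf, pd_comm hf j i, pd_comm hf l i, pd_comm hf l j]
    split_ifs <;> field_simp <;> ring
  simp only [christoffel, h1, Finset.sum_sub_distrib, ← Finset.mul_sum]
  change 1 / 2 * (_ - _ * gradSq f x) = _
  simp
  field_simp
  ring

/-! ### The scalar curvature of a graph -/

lemma pd_christoffel_graphMap (T : E (n + 1) ≃ᵃⁱ[ℝ] WithLp 2 (E n × ℝ)) {f : E n → ℝ} {x : E n}
    (hf : ContDiffAt ℝ 3 f x) (m k i j : Fin n) :
    pd m (christoffel (inducedMetric (graphMap T f)) k i j) x =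
      (pd m (pd i (pd j f)) x * pd k f x + pd i (pd j f) x * pd m (pd k f) x) / (1 + gradSq f x) -
        pd i (pd j f) x * pd k f x * (2 * ∑ l, pd l f x * pd m (pd l f) x) /
          (1 + gradSq f x) ^ 2 := by
  have hd (k : Fin n) : ContDiffAt ℝ 2 (pd k f) x := ContDiffAt.pd (k := 2) hf k
  have hd' (k : Fin n) : DifferentiableAt ℝ (pd k f) x := (hd k).differentiableAt (by norm_num)
  have hdd (k l : Fin n) : DifferentiableAt ℝ (pd k (pd l f)) x :=
    (ContDiffAt.pd (k := 1) (hd l) k).differentiableAt (by norm_num)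
  have hf2 : ContDiffAt ℝ 2 f x := hf.of_le (by norm_num)
  have h : christoffel (inducedMetric (graphMap T f)) k i j =ᶠ[𝓝 x]
      fun y => pd i (pd j f) y * pd k f y / (1 + gradSq f y) := by
    filter_upwards [hf2.eventually (by simp)] with y hy
    exact christoffel_graphMap T hy k i j
  have hW : DifferentiableAt ℝ (fun y => 1 + gradSq f y) x := by
    change DifferentiableAt ℝ (fun y => 1 + ∑ k, pd k f y ^ 2) x
    fun_prop
  rw [pd_congr h, pd_div ((hdd i j).fun_mul (hd' k)) hW (one_add_gradSq_pos f x).ne',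
    pd_mul (hdd i j) (hd' k), pd_gradSq hf2]
  ring

lemma ricci_graphMap (T : E (n + 1) ≃ᵃⁱ[ℝ] WithLp 2 (E n × ℝ)) {f : E n → ℝ} {x : E n}
    (hf : ContDiffAt ℝ 3 f x) (i j : Fin n) :
    ricci (inducedMetric (graphMap T f)) i j x =
      (pd i (pd j f) x * ∑ k, pd k (pd k f) x - ∑ k, pd i (pd k f) x * pd j (pd k f) x) /
          (1 + gradSq f x) -
        (pd i (pd j f) x * ∑ k, pd k f x * ∑ l, pd l f x * pd k (pd l f) x -
            (∑ l, pd l f x * pd i (pd l f) x) * ∑ l, pd l f x * pd j (pd l f) x) /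
          (1 + gradSq f x) ^ 2 := by
  have hf2 : ContDiffAt ℝ 2 f x := hf.of_le (by norm_num)
  have hd (k : Fin n) : ContDiffAt ℝ 2 (pd k f) x := ContDiffAt.pd (k := 2) hf k
  -- Symmetry of third derivatives: it cancels the third-order terms of `∂ₖΓᵏᵢⱼ - ∂ⱼΓᵏᵢₖ`, leaving
  -- an expression in `Df` and `D²f` only.
  have hT (k : Fin n) : pd k (pd i (pd j f)) x = pd j (pd i (pd k f)) x := by
    have hc (a b : Fin n) : pd a (pd b f) =ᶠ[𝓝 x] pd b (pd a f) := by
      filter_upwards [hf2.eventually (by simp)] with y hy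
      exact pd_comm hy a b
    rw [pd_congr (hc i j), pd_comm (hd i), pd_congr (hc k i)]
  have hW := (one_add_gradSq_pos f x).ne'
  simp only [ricci, pd_christoffel_graphMap T hf, christoffel_graphMap T hf2, hT]
  -- `b` is half the gradient of `|Df|²`.
  generalize hb : (fun m => ∑ l, pd l f x * pd m (pd l f) x) = b
  have hb' (m : Fin n) : ∑ l, pd l f x * pd m (pd l f) x = b m := by rw [← hb]
  generalize 1 + gradSq f x = W at hW
  have hsum (k : Fin n) : ∑ l, (pd k (pd l f) x * pd k f x / W * (pd i (pd j f) x * pd l f x / W) -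
      pd j (pd l f) x * pd k f x / W * (pd i (pd k f) x * pd l f x / W)) =
      (pd k f x * pd i (pd j f) x * b k - pd k f x * pd i (pd k f) x * b j) / W ^ 2 := by
    rw [← hb', ← hb', Finset.mul_sum, Finset.mul_sum, ← Finset.sum_sub_distrib, Finset.sum_div]
    refine Finset.sum_congr rfl fun l _ => ?_
    field_simp
  simp only [hsum, hb']
  rw [← hb' i, Finset.mul_sum, Finset.mul_sum, Finset.sum_mul, ← Finset.sum_sub_distrib,
    ← Finset.sum_sub_distrib, Finset.sum_div, Finset.sum_div, ← Finset.sum_sub_distrib]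
  refine Finset.sum_congr rfl fun k _ => ?_
  field_simp
  ring

lemma scalarCurvature_graphMap (T : E (n + 1) ≃ᵃⁱ[ℝ] WithLp 2 (E n × ℝ)) {f : E n → ℝ} {x : E n}
    (hf : ContDiffAt ℝ 3 f x) :
    scalarCurvature (inducedMetric (graphMap T f)) x =
      ((∑ k, pd k (pd k f) x) ^ 2 - ∑ i, ∑ k, pd i (pd k f) x ^ 2) / (1 + gradSq f x) -
        2 * ((∑ k, pd k (pd k f) x) * ∑ k, pd k f x * ∑ l, pd l f x * pd k (pd l f) x -
          ∑ k, (∑ l, pd l f x * pd k (pd l f) x) ^ 2) / (1 + gradSq f x) ^ 2 := by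
  have hf2 : ContDiffAt ℝ 2 f x := hf.of_le (by norm_num)
  have hW := (one_add_gradSq_pos f x).ne'
  simp only [scalarCurvature, ricci_graphMap T hf,
    inducedMetric_graphMap_inv T (hf2.differentiableAt (by norm_num))]
  have hA (i j : Fin n) := pd_comm hf2 i j
  generalize 1 + gradSq f x = W at hW
  generalize hAA : (fun i j => pd i (pd j f) x) = A
  have hA' (i j : Fin n) : pd i (pd j f) x = A i j := by rw [← hAA]
  simp only [hA'] at hA ⊢
  generalize hb : (fun m => ∑ l, pd l f x * A m l) = b
  have hb' (m : Fin n) : ∑ l, pd l f x * A m l = b m := by rw [← hb]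
  simp only [hb']
  generalize haa : (fun m => pd m f x) = a
  have ha' (m : Fin n) : pd m f x = a m := by rw [← haa]
  simp only [ha'] at hb' ⊢
  generalize hH : ∑ k, A k k = H
  generalize hc : ∑ k, a k * b k = c
  -- The `δᵢⱼ` part of `g⁻¹` gives the trace. The `aᵢaⱼ` part is grouped into the three contractions
  -- `h2`, `h3`, `h4`; its `c²` terms cancel.
  have h1 (i j : Fin n) : ((if i = j then 1 else 0) - a i * a j / W) *
      ((A i j * H - ∑ k, A i k * A j k) / W - (A i j * c - b i * b j) / W ^ 2) =
      (if i = j then (A i j * H - ∑ k, A i k * A j k) / W - (A i j * c - b i * b j) / W ^ 2 else 0)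
        - ((a i * (a j * A i j)) * (H / W ^ 2 - c / W ^ 3) -
          (∑ k, (a i * A i k) * (a j * A j k)) / W ^ 2 + (a i * b i) * (a j * b j) / W ^ 3) := by
    have : ∑ k, (a i * A i k) * (a j * A j k) = a i * a j * ∑ k, A i k * A j k := by
      rw [Finset.mul_sum]
      exact Finset.sum_congr rfl fun k _ => by ring
    rw [this]
    split_ifs <;> field_simp <;> ring
  have h2 : ∑ i, ∑ j, a i * (a j * A i j) = c := by
    simp only [← Finset.mul_sum, hb', hc]
  have h3 : ∑ i, ∑ j, ∑ k, (a i * A i k) * (a j * A j k) = ∑ k, b k ^ 2 := by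
    rw [Finset.sum_congr rfl fun i _ => Finset.sum_comm, Finset.sum_comm]
    refine Finset.sum_congr rfl fun k _ => ?_
    simp only [← Finset.mul_sum, ← Finset.sum_mul]
    rw [← hb' k, sq]
    simp only [hA k]
  have h4 : ∑ i, ∑ j, (a i * b i) * (a j * b j) = c ^ 2 := by
    simp only [← Finset.mul_sum, ← Finset.sum_mul, hc, sq]
  have h5 : ∑ i, A i i * H = H ^ 2 := by rw [← Finset.sum_mul, hH, sq]
  have h6 : ∑ i, A i i * c = H * c := by rw [← Finset.sum_mul, hH]
  simp only [h1, Finset.sum_sub_distrib, Finset.sum_add_distrib, ← Finset.sum_div,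
    ← Finset.sum_mul, h2, h3, h4, Finset.sum_ite_eq, Finset.mem_univ, if_true, h5, h6, ← sq]
  field_simp
  ring

/-! ### The mass vector field and its divergence -/

/-- The vector field whose flux through large spheres is the graphical mass. -/
def massField (f : E n → ℝ) (j : Fin n) (x : E n) : ℝ :=
  (∑ i, (pd i (pd i f) x * pd j f x - pd i (pd j f) x * pd i f x)) / (1 + gradSq f x)

lemma massIntegrand_eq (f : E n → ℝ) (x : E n) :
    massIntegrand f x = ∑ j, massField f j x * (x j / ‖x‖) := by
  rw [massIntegrand, Finset.sum_comm, Finset.mul_sum]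
  refine Finset.sum_congr rfl fun j _ => ?_
  rw [massField, ← Finset.sum_mul]
  ring

/-- Two derivatives of `f` are consumed, so class `C³` is what allows the divergence to be taken
classically. -/
lemma contDiffAt_massField {f : E n → ℝ} {x : E n} (hf : ContDiffAt ℝ 3 f x) (j : Fin n) :
    ContDiffAt ℝ 1 (massField f j) x := by
  have hd (k : Fin n) : ContDiffAt ℝ 2 (pd k f) x := ContDiffAt.pd (k := 2) hf k
  have hd' (k : Fin n) : ContDiffAt ℝ 1 (pd k f) x := (hd k).of_le (by norm_num)
  have hdd (k l : Fin n) : ContDiffAt ℝ 1 (pd k (pd l f)) x := ContDiffAt.pd (k := 1) (hd l) k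
  refine ContDiffAt.div (ContDiffAt.sum fun i _ => ?_) ?_ (one_add_gradSq_pos f x).ne'
  · exact ((hdd i i).mul (hd' j)).sub ((hdd i j).mul (hd' i))
  · exact contDiffAt_const.add (ContDiffAt.sum fun i _ => (hd' i).pow 2)

/-- The scalar curvature of a graph is a divergence. -/
lemma scalarCurvature_eq_sum_pd_massField (T : E (n + 1) ≃ᵃⁱ[ℝ] WithLp 2 (E n × ℝ)) {f : E n → ℝ}
    {x : E n} (hf : ContDiffAt ℝ 3 f x) :
    scalarCurvature (inducedMetric (graphMap T f)) x = ∑ j, pd j (massField f j) x := by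
  have hd (k : Fin n) : ContDiffAt ℝ 2 (pd k f) x := ContDiffAt.pd (k := 2) hf k
  have hd' (k : Fin n) : DifferentiableAt ℝ (pd k f) x := (hd k).differentiableAt (by norm_num)
  have hdd (k l : Fin n) : DifferentiableAt ℝ (pd k (pd l f)) x :=
    (ContDiffAt.pd (k := 1) (hd l) k).differentiableAt (by norm_num)
  have hf2 : ContDiffAt ℝ 2 f x := hf.of_le (by norm_num)
  have hW : DifferentiableAt ℝ (fun y => 1 + gradSq f y) x := by
    change DifferentiableAt ℝ (fun y => 1 + ∑ k, pd k f y ^ 2) x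
    fun_prop
  have hV (j : Fin n) : pd j (massField f j) x =
      (∑ i, (pd j (pd i (pd i f)) x * pd j f x + pd i (pd i f) x * pd j (pd j f) x
        - (pd j (pd i (pd j f)) x * pd i f x + pd i (pd j f) x * pd j (pd i f) x))) /
          (1 + gradSq f x) -
        (∑ i, (pd i (pd i f) x * pd j f x - pd i (pd j f) x * pd i f x)) *
          (2 * ∑ l, pd l f x * pd j (pd l f) x) / (1 + gradSq f x) ^ 2 := by
    have hs (i : Fin n) : DifferentiableAt ℝ
        (fun y => pd i (pd i f) y * pd j f y - pd i (pd j f) y * pd i f y) x :=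
      ((hdd i i).mul (hd' j)).sub ((hdd i j).mul (hd' i))
    unfold massField
    rw [pd_div (DifferentiableAt.fun_sum fun i _ => hs i) hW (one_add_gradSq_pos f x).ne',
      pd_gradSq hf2, pd_sum fun i _ => hs i]
    congr 2
    refine Finset.sum_congr rfl fun i _ => ?_
    rw [pd_sub ((hdd i i).fun_mul (hd' j)) ((hdd i j).fun_mul (hd' i)), pd_mul (hdd i i) (hd' j),
      pd_mul (hdd i j) (hd' i)]
    ring
  have hT (i j : Fin n) : pd i (pd j (pd i f)) x = pd j (pd i (pd i f)) x := pd_comm (hd i) i j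
  have hA (i j : Fin n) := pd_comm hf2 i j
  have hW := (one_add_gradSq_pos f x).ne'
  simp only [hV, scalarCurvature_graphMap T hf]
  -- The third derivatives in the divergence cancel after exchanging the two summation indices.
  have hthird : ∑ j, ∑ i, pd j (pd i (pd j f)) x * pd i f x =
      ∑ j, ∑ i, pd j (pd i (pd i f)) x * pd j f x := by
    rw [Finset.sum_comm]
    exact Finset.sum_congr rfl fun i _ => Finset.sum_congr rfl fun j _ => by rw [hT]
  have h1 (j : Fin n) : ∑ i, pd i (pd j f) x * pd i f x = ∑ l, pd l f x * pd j (pd l f) x :=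
    Finset.sum_congr rfl fun i _ => by rw [hA i j, mul_comm]
  have h2 : ∑ j, ∑ i, pd i (pd j f) x * pd j (pd i f) x = ∑ i, ∑ k, pd i (pd k f) x ^ 2 :=
    Finset.sum_congr rfl fun i _ => Finset.sum_congr rfl fun j _ => by rw [hA j i, sq]
  simp only [Finset.sum_sub_distrib, Finset.sum_add_distrib, ← Finset.sum_div, hthird, h1, h2,
    ← Finset.sum_mul, ← Finset.mul_sum]
  generalize hb : (fun m => ∑ l, pd l f x * pd m (pd l f) x) = b
  have hb' (m : Fin n) : ∑ l, pd l f x * pd m (pd l f) x = b m := by rw [← hb]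
  simp only [hb']
  generalize ∑ k, pd k (pd k f) x = H
  -- This is the contribution of differentiating the denominator `1 + |Df|²`.
  have h3 : ∑ j, (H * pd j f x - b j) * (2 * b j) =
      2 * (H * ∑ k, pd k f x * b k - ∑ k, b k ^ 2) := by
    rw [Finset.mul_sum, ← Finset.sum_sub_distrib, Finset.mul_sum]
    exact Finset.sum_congr rfl fun k _ => by ring
  rw [h3]
  ring

/-! ### Integration in polar coordinates -/

lemma integrable_comp_polar {g : E n → ℝ} (hg : Integrable g) :
    Integrable (fun p : Metric.sphere (0 : E n) 1 × Ioi (0 : ℝ) => g ((p.2 : ℝ) • (p.1 : E n)))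
      ((volume : Measure (E n)).toSphere.prod (.volumeIoiPow (n - 1))) := by
  have h := (volume : Measure (E n)).measurePreserving_homeomorphUnitSphereProd
  rw [finrank_euclideanSpace_fin] at h
  rw [← h.integrable_comp_emb (Homeomorph.measurableEmbedding _)]
  have : (fun p : Metric.sphere (0 : E n) 1 × Ioi (0 : ℝ) => g ((p.2 : ℝ) • (p.1 : E n))) ∘
      homeomorphUnitSphereProd (E n) = g ∘ Subtype.val := by
    ext x
    have hx : ‖(x : E n)‖ ≠ 0 := norm_ne_zero_iff.2 x.2
    simp [smul_smul, hx]
  rw [this, ← integrableOn_iff_comap_subtypeVal (measurableSet_singleton _).compl]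
  exact hg.integrableOn

lemma integral_volumeIoiPow (m : ℕ) (h : ℝ → ℝ) :
    ∫ r : Ioi (0 : ℝ), h r ∂(Measure.volumeIoiPow m) = ∫ r in Ioi (0 : ℝ), r ^ m * h r := by
  simp only [Measure.volumeIoiPow, ENNReal.ofReal]
  rw [integral_withDensity_eq_integral_smul (by fun_prop),
    integral_subtype_comap measurableSet_Ioi fun a ↦ Real.toNNReal (a ^ m) • h a]
  refine setIntegral_congr_fun measurableSet_Ioi fun x hx => ?_
  simp only [NNReal.smul_def, Real.coe_toNNReal _ (pow_nonneg (le_of_lt hx) _), smul_eq_mul]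

lemma integrable_volumeIoiPow_iff (m : ℕ) (h : ℝ → ℝ) :
    Integrable (fun r : Ioi (0 : ℝ) => h r) (Measure.volumeIoiPow m) ↔
      IntegrableOn (fun r => r ^ m * h r) (Ioi 0) := by
  rw [integrableOn_iff_comap_subtypeVal measurableSet_Ioi, Measure.volumeIoiPow,
    integrable_withDensity_iff_integrable_smul' (by fun_prop) (by simp), integrable_congr]
  refine .of_forall ?_
  rintro ⟨x, hx : 0 < x⟩
  simp (disch := positivity) [ENNReal.toReal_ofReal]

lemma integral_eq_integral_sphereIntegral (hn : n ≠ 0) {g : E n → ℝ} (hg : Integrable g) :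
    ∫ x, g x = ∫ r in Ioi (0 : ℝ), sphereIntegral r g := by
  have : Nonempty (Fin n) := ⟨⟨0, Nat.pos_of_ne_zero hn⟩⟩
  have h := (volume : Measure (E n)).measurePreserving_homeomorphUnitSphereProd
  rw [finrank_euclideanSpace_fin] at h
  calc ∫ x, g x = ∫ x : ({0}ᶜ : Set (E n)), g x ∂(volume.comap Subtype.val) := by
        rw [integral_subtype_comap (measurableSet_singleton _).compl g, restrict_compl_singleton]
    _ = ∫ p : Metric.sphere (0 : E n) 1 × Ioi (0 : ℝ), g ((p.2 : ℝ) • (p.1 : E n))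
          ∂((volume : Measure (E n)).toSphere.prod (.volumeIoiPow (n - 1))) := by
        rw [← h.integral_comp (Homeomorph.measurableEmbedding _)]
        refine integral_congr_ae (.of_forall fun x => ?_)
        have hx : ‖(x : E n)‖ ≠ 0 := norm_ne_zero_iff.2 x.2
        simp [smul_smul, hx]
    _ = ∫ r : Ioi (0 : ℝ), ∫ ω : Metric.sphere (0 : E n) 1, g ((r : ℝ) • (ω : E n))
          ∂(volume : Measure (E n)).toSphere ∂(Measure.volumeIoiPow (n - 1)) :=
        integral_prod_symm _ (integrable_comp_polar hg)
    _ = _ := integral_volumeIoiPow (n - 1) fun r => ∫ ω : Metric.sphere (0 : E n) 1,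
          g (r • (ω : E n)) ∂(volume : Measure (E n)).toSphere

/-- Fubini in polar coordinates; the factor `r ^ (n - 1)` of `sphereIntegral` is the density of the
radial measure. -/
lemma integrableOn_sphereIntegral {g : E n → ℝ} (hg : Integrable g) :
    IntegrableOn (fun r => sphereIntegral r g) (Ioi 0) :=
  (integrable_volumeIoiPow_iff (n - 1) fun r => ∫ ω : Metric.sphere (0 : E n) 1,
    g (r • (ω : E n)) ∂(volume : Measure (E n)).toSphere).1
    (integrable_comp_polar hg).integral_prod_right

lemma sphereIntegral_congr {g h : E n → ℝ} {r : ℝ} (hr : 0 ≤ r)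
    (hgh : ∀ x : E n, ‖x‖ = r → g x = h x) : sphereIntegral r g = sphereIntegral r h := by
  unfold sphereIntegral
  congr 1
  refine integral_congr_ae (.of_forall fun ω => hgh _ ?_)
  simp [norm_smul, abs_of_nonneg hr]

lemma abs_sphereIntegral_le {g : E n → ℝ} {r C : ℝ} (hr : 0 ≤ r)
    (hg : ∀ x : E n, ‖x‖ = r → |g x| ≤ C) :
    |sphereIntegral r g| ≤ r ^ (n - 1) * (C * sphereVolume n) := by
  unfold sphereIntegral
  rw [abs_mul, abs_of_nonneg (pow_nonneg hr _)]
  gcongr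
  have h (ω : Metric.sphere (0 : E n) 1) : ‖g (r • (ω : E n))‖ ≤ C :=
    hg _ (by simp [norm_smul, abs_of_nonneg hr])
  exact norm_integral_le_of_norm_le_const (μ := (volume : Measure (E n)).toSphere) (.of_forall h)

lemma continuous_sphereIntegral {g : E n → ℝ} (hg : Continuous g) :
    Continuous fun r => sphereIntegral r g := by
  refine (continuous_pow _).mul ?_
  have := continuous_parametric_integral_of_continuous
    (f := fun (r : ℝ) (ω : Metric.sphere (0 : E n) 1) => g (r • (ω : E n)))
    (μ := (volume : Measure (E n)).toSphere) (s := univ) (by fun_prop) isCompact_univ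
  simpa using this

/-! ### The divergence theorem on annuli -/

/-- The flux of a `C¹` vector field through the sphere of radius `r`, as a function of `r`. -/
def flux (V : Fin n → E n → ℝ) (r : ℝ) : ℝ :=
  r ^ (n - 1) * ∫ ω : Metric.sphere (0 : E n) 1, ∑ j, V j (r • (ω : E n)) * (ω : E n) j
    ∂(volume : Measure (E n)).toSphere

/-- `flux` uses `ω` as the normal instead of `x / ‖x‖`, so that it is `C¹` on all of `ℝ`, including
at `r = 0`. -/
lemma flux_eq_sphereIntegral (V : Fin n → E n → ℝ) {r : ℝ} (hr : 0 < r) :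
    flux V r = sphereIntegral r fun x => ∑ j, V j x * (x j / ‖x‖) := by
  unfold flux sphereIntegral
  congr 1
  refine integral_congr_ae (.of_forall fun ω => ?_)
  simp [norm_smul, abs_of_pos hr, hr.ne']

lemma contDiff_flux {V : Fin n → E n → ℝ} (hV : ∀ j, ContDiff ℝ 1 (V j)) :
    ContDiff ℝ 1 (flux V) := by
  refine (contDiff_id.pow _).mul ?_
  set G : ℝ → Metric.sphere (0 : E n) 1 → ℝ := fun r ω =>
    ∑ j, V j (r • (ω : E n)) * (ω : E n) j
  set G' : ℝ → Metric.sphere (0 : E n) 1 → ℝ := fun r ω =>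
    ∑ j, fderiv ℝ (V j) (r • (ω : E n)) (ω : E n) * (ω : E n) j
  have hVf (j : Fin n) : Continuous (fderiv ℝ (V j)) := (hV j).continuous_fderiv (by norm_num)
  have hVc (j : Fin n) : Continuous (V j) := (hV j).continuous
  have hco (j : Fin n) : Continuous fun ω : Metric.sphere (0 : E n) 1 => (ω : E n) j := by fun_prop
  have hG : Continuous G.uncurry := by
    refine continuous_finsetSum _ fun j _ => ?_
    exact ((hVc j).comp (by fun_prop)).mul ((hco j).comp continuous_snd)
  have hG' : Continuous G'.uncurry := by
    refine continuous_finsetSum _ fun j _ => ?_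
    refine Continuous.mul ?_ ((hco j).comp continuous_snd)
    exact ((hVf j).comp (by fun_prop)).clm_apply (by fun_prop)
  have hint {f : ℝ → Metric.sphere (0 : E n) 1 → ℝ} (hf : Continuous f.uncurry) (r : ℝ) :
      Integrable (f r) (volume : Measure (E n)).toSphere :=
    (hf.comp (by fun_prop : Continuous fun ω => (r, ω))).integrable_of_hasCompactSupport
      (HasCompactSupport.of_compactSpace _)
  have hder (r : ℝ) : HasDerivAt (fun r => ∫ ω, G r ω ∂(volume : Measure (E n)).toSphere)
      (∫ ω, G' r ω ∂(volume : Measure (E n)).toSphere) r := by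
    -- Compactness of `[r - 1, r + 1] × S` bounds the derivative, which justifies differentiation
    -- under the integral.
    obtain ⟨C, hC⟩ := ((isCompact_Icc (a := r - 1) (b := r + 1)).prod
      (isCompact_univ (X := Metric.sphere (0 : E n) 1))).exists_bound_of_continuousOn
        hG'.continuousOn
    refine (hasDerivAt_integral_of_dominated_loc_of_deriv_le (F := G) (F' := G') (bound := fun _ => C)
      (s := Icc (r - 1) (r + 1)) (Icc_mem_nhds (by linarith) (by linarith))
      (.of_forall fun s => (hint hG s).aestronglyMeasurable) (hint hG r)
      (hint hG' r).aestronglyMeasurable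
      (.of_forall fun ω s hs => hC (s, ω) ⟨hs, mem_univ _⟩) (integrable_const _)
      (.of_forall fun ω s _ => ?_)).2
    refine HasDerivAt.fun_sum fun j _ => HasDerivAt.mul_const ?_ _
    have h1 : HasDerivAt (fun s : ℝ => s • (ω : E n)) (ω : E n) s := by
      simpa using (hasDerivAt_id s).smul_const (ω : E n)
    exact ((hV j).differentiable (by norm_num) _).hasFDerivAt.comp_hasDerivAt s h1
  refine contDiff_one_iff_deriv.2 ⟨fun r => (hder r).differentiableAt, ?_⟩
  rw [funext fun r => (hder r).deriv]
  simpa using continuous_parametric_integral_of_continuous (f := G')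
    (μ := (volume : Measure (E n)).toSphere) (s := univ) hG' isCompact_univ

/-- The divergence of a vector field. -/
def divergence (V : Fin n → E n → ℝ) (x : E n) : ℝ := ∑ j, pd j (V j) x

/-- The norm is not differentiable at the origin, but `φ` vanishes near `0`. -/
lemma contDiff_comp_norm {φ : ℝ → ℝ} (hφ : ContDiff ℝ 1 φ) (h0 : (0 : ℝ) ∉ tsupport φ) :
    ContDiff ℝ 1 fun x : E n => φ ‖x‖ := by
  rw [contDiff_iff_contDiffAt]
  intro x
  by_cases hx : x = 0
  · subst hx
    have h1 : ∀ᶠ t in 𝓝 (0 : ℝ), φ t = 0 := notMem_tsupport_iff_eventuallyEq.1 h0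
    have h2 : Tendsto (fun x : E n => ‖x‖) (𝓝 0) (𝓝 0) := by
      simpa using (continuous_norm (E := E n)).tendsto 0
    exact (contDiffAt_const (c := (0 : ℝ))).congr_of_eventuallyEq (h2.eventually h1)
  · exact hφ.contDiffAt.comp x (contDiffAt_norm ℝ hx)

lemma pd_comp_norm {φ : ℝ → ℝ} (hφ : ContDiff ℝ 1 φ) (h0 : (0 : ℝ) ∉ tsupport φ) (j : Fin n)
    (x : E n) : pd j (fun x : E n => φ ‖x‖) x = deriv φ ‖x‖ * (x j / ‖x‖) := by
  by_cases hx : x = 0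
  · subst hx
    have h1 : ∀ᶠ t in 𝓝 (0 : ℝ), φ t = 0 := notMem_tsupport_iff_eventuallyEq.1 h0
    have h2 : Tendsto (fun x : E n => ‖x‖) (𝓝 0) (𝓝 0) := by
      simpa using (continuous_norm (E := E n)).tendsto 0
    rw [pd_congr (v := fun _ => (0 : ℝ)) (h2.eventually h1), pd_const]
    simp
  · have hx' : ‖x‖ ≠ 0 := norm_ne_zero_iff.2 hx
    have h1 : HasFDerivAt (fun y : E n => ‖y‖ ^ 2) (2 • innerSL ℝ x) x :=
      (hasStrictFDerivAt_norm_sq x).hasFDerivAt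
    have hd : DifferentiableAt ℝ (fun y : E n => ‖y‖) x :=
      (contDiffAt_norm ℝ hx (n := 1)).differentiableAt (by norm_num)
    have h2 : pd j (fun y : E n => ‖y‖) x = x j / ‖x‖ := by
      have h3 : pd j (fun y : E n => ‖y‖ * ‖y‖) x = 2 * x j := by
        simp only [← sq]
        simp [pd, h1.fderiv, EuclideanSpace.inner_single_right]
      rw [pd_mul hd hd] at h3
      field_simp
      linarith
    have h4 := ((hφ.differentiable (by norm_num) ‖x‖).hasDerivAt.comp_hasFDerivAt x
      hd.hasFDerivAt).fderiv
    rw [← h2]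
    change fderiv ℝ (φ ∘ fun y => ‖y‖) x _ = _
    rw [h4]
    simp [pd]

/-- Integration by parts in each coordinate; the compact support of `ψ` leaves no boundary term. -/
lemma integral_mul_divergence {V : Fin n → E n → ℝ} (hV : ∀ j, ContDiff ℝ 1 (V j))
    {ψ : E n → ℝ} (hψ : ContDiff ℝ 1 ψ) (hc : HasCompactSupport ψ) :
    ∫ x, ψ x * divergence V x = - ∫ x, ∑ j, pd j ψ x * V j x := by
  have hVf (j : Fin n) : Continuous fun x => pd j (V j) x :=
    ((hV j).continuous_fderiv (by norm_num)).clm_apply continuous_const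
  have hψf (j : Fin n) : Continuous fun x => pd j ψ x :=
    (hψ.continuous_fderiv (by norm_num)).clm_apply continuous_const
  have hcf (j : Fin n) : HasCompactSupport fun x => pd j ψ x := hc.fderiv_apply ℝ _
  have hi1 (j : Fin n) : Integrable fun x => ψ x * pd j (V j) x :=
    (hψ.continuous.mul (hVf j)).integrable_of_hasCompactSupport hc.mul_right
  have hi2 (j : Fin n) : Integrable fun x => pd j ψ x * V j x :=
    ((hψf j).mul (hV j).continuous).integrable_of_hasCompactSupport (hcf j).mul_right
  have hi3 (j : Fin n) : Integrable fun x => ψ x * V j x :=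
    (hψ.continuous.mul (hV j).continuous).integrable_of_hasCompactSupport hc.mul_right
  simp only [divergence, Finset.mul_sum]
  rw [integral_finsetSum _ fun j _ => hi1 j, integral_finsetSum _ fun j _ => hi2 j,
    ← Finset.sum_neg_distrib]
  refine Finset.sum_congr rfl fun j _ => ?_
  exact integral_mul_fderiv_eq_neg_fderiv_mul_of_integrable (hi2 j) (hi1 j) (hi3 j)
    (fun x _ => hψ.differentiable (by norm_num) x)
    (fun x _ => (hV j).differentiable (by norm_num) x)

lemma continuous_divergence {V : Fin n → E n → ℝ} (hV : ∀ j, ContDiff ℝ 1 (V j)) :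
    Continuous (divergence V) :=
  continuous_finsetSum _ fun j _ =>
    ((hV j).continuous_fderiv (by norm_num)).clm_apply continuous_const

lemma sphereIntegral_radial_mul (φ : ℝ → ℝ) (g : E n → ℝ) {r : ℝ} (hr : 0 ≤ r) :
    sphereIntegral r (fun x => φ ‖x‖ * g x) = φ r * sphereIntegral r g := by
  rw [sphereIntegral_congr hr (h := fun x => φ r * g x) fun x hx => by rw [hx]]
  unfold sphereIntegral
  rw [integral_const_mul]
  ring

lemma hasCompactSupport_comp_norm {φ : ℝ → ℝ} (hc : HasCompactSupport φ) :
    HasCompactSupport fun x : E n => φ ‖x‖ := by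
  obtain ⟨R, hR⟩ := hc.isCompact.isBounded.subset_closedBall 0
  refine HasCompactSupport.of_support_subset_isCompact (isCompact_closedBall (0 : E n) R)
    fun x hx => ?_
  simpa using hR (subset_tsupport φ (Function.mem_support.2 (Function.mem_support.1 hx)))

/-- The weak form of `deriv_flux`: integrate by parts against the radial test function `φ ‖x‖`,
whose gradient is `φ'(r) x / r`, and pass to polar coordinates on both sides. -/
lemma setIntegral_mul_sphereIntegral_divergence (hn : n ≠ 0) {V : Fin n → E n → ℝ}
    (hV : ∀ j, ContDiff ℝ 1 (V j)) {φ : ℝ → ℝ} (hφ : ContDiff ℝ 1 φ) (hc : HasCompactSupport φ)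
    (h0 : tsupport φ ⊆ Ioi 0) :
    ∫ r in Ioi (0 : ℝ), φ r * sphereIntegral r (divergence V) =
      - ∫ r in Ioi (0 : ℝ), deriv φ r * flux V r := by
  have h0' : (0 : ℝ) ∉ tsupport φ := fun h => lt_irrefl (0 : ℝ) (h0 h)
  have hψ := contDiff_comp_norm (n := n) hφ h0'
  have hcψ := hasCompactSupport_comp_norm (n := n) hc
  have hψf (j : Fin n) : Continuous fun x => pd j (fun x : E n => φ ‖x‖) x :=
    (hψ.continuous_fderiv (by norm_num)).clm_apply continuous_const
  have hcf (j : Fin n) : HasCompactSupport fun x => pd j (fun x : E n => φ ‖x‖) x :=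
    hcψ.fderiv_apply ℝ _
  have h := integral_mul_divergence hV hψ hcψ
  rw [integral_eq_integral_sphereIntegral hn (g := fun x => φ ‖x‖ * divergence V x)
      ((hψ.continuous.mul (continuous_divergence hV)).integrable_of_hasCompactSupport hcψ.mul_right),
    integral_eq_integral_sphereIntegral hn
      (g := fun x => ∑ j, pd j (fun x : E n => φ ‖x‖) x * V j x) (integrable_finsetSum _ fun j _ =>
      ((hψf j).mul (hV j).continuous).integrable_of_hasCompactSupport (hcf j).mul_right)] at h
  rw [setIntegral_congr_fun measurableSet_Ioi fun r hr =>
    (sphereIntegral_radial_mul φ (divergence V) (le_of_lt hr)).symm, h]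
  congr 1
  refine setIntegral_congr_fun measurableSet_Ioi fun r hr => ?_
  rw [flux_eq_sphereIntegral V hr, ← sphereIntegral_radial_mul _ _ (le_of_lt hr)]
  congr 1
  ext x
  rw [Finset.mul_sum]
  refine Finset.sum_congr rfl fun j _ => ?_
  rw [pd_comp_norm hφ h0']
  ring

/-- The derivative of the flux through the sphere of radius `r` is the integral of the divergence
over this sphere. -/
lemma deriv_flux (hn : n ≠ 0) {V : Fin n → E n → ℝ} (hV : ∀ j, ContDiff ℝ 1 (V j)) {r : ℝ}
    (hr : 0 < r) : deriv (flux V) r = sphereIntegral r (divergence V) := by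
  have hF := contDiff_flux hV
  have hF' : Continuous (deriv (flux V)) := hF.continuous_deriv (by norm_num)
  have hD := continuous_sphereIntegral (continuous_divergence hV)
  -- Fundamental lemma of the calculus of variations: integration by parts on `ℝ^n` (`h1`) and on
  -- the line (`h2`) give the same pairing with every test function.
  have hae : ∀ᵐ r : ℝ, r ∈ Ioi (0 : ℝ) →
      sphereIntegral r (divergence V) - deriv (flux V) r = 0 := by
    refine isOpen_Ioi.ae_eq_zero_of_integral_contDiff_smul_eq_zero
      ((hD.sub hF').locallyIntegrable.locallyIntegrableOn _) fun φ hφ hc h0 => ?_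
    have hφ1 : ContDiff ℝ 1 φ := hφ.of_le (by norm_cast)
    have hsub {g h : ℝ → ℝ} (hg : Function.support g ⊆ tsupport φ) :
        ∫ r in Ioi (0 : ℝ), g r * h r = ∫ r, g r * h r :=
      setIntegral_eq_integral_of_forall_compl_eq_zero fun r hr => by
        rw [Function.notMem_support.1 fun hh => hr (h0 (hg hh)), zero_mul]
    have h1 := setIntegral_mul_sphereIntegral_divergence hn hV hφ1 hc h0
    rw [hsub (subset_tsupport φ), hsub (support_deriv_subset)] at h1
    have hφ' : Continuous (deriv φ) := hφ1.continuous_deriv (by norm_num)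
    have i1 : Integrable fun r => φ r * deriv (flux V) r :=
      (hφ.continuous.mul hF').integrable_of_hasCompactSupport hc.mul_right
    have i2 : Integrable fun r => deriv φ r * flux V r :=
      (hφ'.mul hF.continuous).integrable_of_hasCompactSupport hc.deriv.mul_right
    have i3 : Integrable fun r => φ r * flux V r :=
      (hφ.continuous.mul hF.continuous).integrable_of_hasCompactSupport hc.mul_right
    have i4 : Integrable fun r => φ r * sphereIntegral r (divergence V) :=
      (hφ.continuous.mul hD).integrable_of_hasCompactSupport hc.mul_right
    have h2 := integral_mul_deriv_eq_deriv_mul_of_integrable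
      (fun r _ => (hφ1.differentiable (by norm_num) r).hasDerivAt)
      (fun r _ => (hF.differentiable (by norm_num) r).hasDerivAt) i1 i2 i3
    simp only [smul_eq_mul, mul_sub]
    rw [integral_sub i4 i1, h1, h2, sub_self]
  -- Both sides are continuous, so equality almost everywhere is equality everywhere.
  have hEq : EqOn (fun r => sphereIntegral r (divergence V) - deriv (flux V) r) (fun _ => 0)
      (Ioi 0) :=
    Measure.eqOn_open_of_ae_eq ((ae_restrict_iff' measurableSet_Ioi).2 hae) isOpen_Ioi
      (hD.sub hF').continuousOn continuousOn_const
  exact (sub_eq_zero.1 (hEq hr)).symm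

/-- A vector field with integrable divergence has a finite flux at infinity. -/
lemma exists_tendsto_flux (hn : n ≠ 0) {V : Fin n → E n → ℝ} (hV : ∀ j, ContDiff ℝ 1 (V j))
    {r₀ : ℝ} (h0 : 0 < r₀) (hint : IntegrableOn (divergence V) {x | r₀ < ‖x‖}) :
    ∃ m, Tendsto (flux V) atTop (𝓝 m) := by
  have hmeas : MeasurableSet {x : E n | r₀ < ‖x‖} :=
    (isOpen_lt continuous_const continuous_norm).measurableSet
  have h1 := (integrableOn_sphereIntegral ((integrable_indicator_iff hmeas).2 hint)).mono_set
    (Ioi_subset_Ioi h0.le)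
  have h2 : IntegrableOn (deriv (flux V)) (Ioi r₀) := by
    refine h1.congr_fun (fun r hr => ?_) measurableSet_Ioi
    have hr' : 0 < r := h0.trans hr
    simp only
    rw [deriv_flux hn hV hr']
    refine sphereIntegral_congr hr'.le fun x hx => indicator_of_mem ?_ _
    change r₀ < ‖x‖
    rw [hx]
    exact hr
  have hF := contDiff_flux hV
  have h3 := intervalIntegral_tendsto_integral_Ioi r₀ h2 tendsto_id
  refine ⟨_, (h3.add_const (flux V r₀)).congr fun r => ?_⟩
  rw [intervalIntegral.integral_deriv_eq_sub (fun x _ => hF.differentiable (by norm_num) x)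
    ((hF.continuous_deriv (by norm_num)).intervalIntegrable _ _)]
  simp

/-! ### The graphical mass -/

lemma det_inducedMetric_graphMap (T : E (n + 1) ≃ᵃⁱ[ℝ] WithLp 2 (E n × ℝ)) {f : E n → ℝ} {x : E n}
    (hf : DifferentiableAt ℝ f x) : (inducedMetric (graphMap T f) x).det = 1 + gradSq f x := by
  rw [inducedMetric_graphMap T hf, det_one_add_vecMulVec_self, gradSq]

/-- The density `√det g` is at least `1` on `A`, so Lebesgue measure there is dominated by the
Riemannian volume. -/
lemma integrableOn_of_riemannianVolume {g : E n → Matrix (Fin n) (Fin n) ℝ} {A : Set (E n)}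
    (hA : MeasurableSet A) (hg : ∀ x ∈ A, 1 ≤ (g x).det) {u : E n → ℝ}
    (hu : IntegrableOn u A (riemannianVolume g)) : IntegrableOn u A := by
  refine Integrable.mono_measure hu ?_
  rw [riemannianVolume, restrict_withDensity hA]
  nth_rewrite 1 [← withDensity_one (μ := volume.restrict A)]
  refine withDensity_mono ?_
  filter_upwards [ae_restrict_mem hA] with x hx
  simpa using hg x hx

/-- Multiplying by `1 - b`, with `b` a bump equal to `1` on the ball of radius `r₀ + 1`, removes the
region where the field need not be smooth without changing its flux far out. -/
lemma exists_contDiff_eq_of_norm_ge {V : Fin n → E n → ℝ} {r₀ : ℝ} (h0 : 0 < r₀)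
    (hV : ∀ j x, r₀ < ‖x‖ → ContDiffAt ℝ 1 (V j) x) :
    ∃ V' : Fin n → E n → ℝ, (∀ j, ContDiff ℝ 1 (V' j)) ∧ ∀ j x, r₀ + 2 ≤ ‖x‖ → V' j x = V j x := by
  let b : ContDiffBump (0 : E n) := ⟨r₀ + 1, r₀ + 2, by positivity, by linarith⟩
  refine ⟨fun j x => (1 - b x) * V j x, fun j => contDiff_iff_contDiffAt.2 fun x => ?_,
    fun j x hx => ?_⟩
  · by_cases hx : ‖x‖ < r₀ + 1
    · refine (contDiffAt_const (c := (0 : ℝ))).congr_of_eventuallyEq ?_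
      filter_upwards [(isOpen_lt continuous_norm continuous_const).mem_nhds hx] with y hy
      rw [b.one_of_mem_closedBall (by simpa using le_of_lt hy)]
      ring
    · exact (contDiffAt_const.sub b.contDiffAt).mul (hV j x (by linarith))
  · simp only
    rw [b.zero_of_le_dist (by simpa using hx)]
    ring

lemma exists_tendsto_sphereIntegral_massIntegrand (hn : n ≠ 0)
    (T : E (n + 1) ≃ᵃⁱ[ℝ] WithLp 2 (E n × ℝ)) {f : E n → ℝ} {r₀ : ℝ} (h0 : 0 < r₀)
    (hf : ∀ x, r₀ < ‖x‖ → ContDiffAt ℝ 3 f x)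
    (hR : IntegrableOn (scalarCurvature (inducedMetric (graphMap T f))) {x | r₀ < ‖x‖}
      (riemannianVolume (inducedMetric (graphMap T f)))) :
    ∃ m, Tendsto (fun r => sphereIntegral r (massIntegrand f)) atTop (𝓝 m) := by
  obtain ⟨V, hV, hVf⟩ := exists_contDiff_eq_of_norm_ge (V := massField f) h0
    fun j x hx => contDiffAt_massField (hf x hx) j
  have hopen (r : ℝ) : IsOpen {x : E n | r < ‖x‖} := isOpen_lt continuous_const continuous_norm
  have hint := integrableOn_of_riemannianVolume (hopen r₀).measurableSet (fun x hx => by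
    rw [det_inducedMetric_graphMap T ((hf x hx).differentiableAt (by norm_num))]
    have : 0 ≤ gradSq f x := Finset.sum_nonneg fun i _ => sq_nonneg _
    linarith) hR
  have hdiv : IntegrableOn (divergence V) {x | r₀ + 2 < ‖x‖} := by
    refine (hint.mono_set fun x (hx : r₀ + 2 < ‖x‖) =>
      show r₀ < ‖x‖ by linarith).congr_fun (fun x hx => ?_) (hopen _).measurableSet
    rw [scalarCurvature_eq_sum_pd_massField T (hf x (by change r₀ + 2 < ‖x‖ at hx; linarith))]
    refine Finset.sum_congr rfl fun j _ => pd_congr ?_ j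
    filter_upwards [(hopen _).mem_nhds hx] with y hy
    exact (hVf j y (le_of_lt hy)).symm
  obtain ⟨m, hm⟩ := exists_tendsto_flux hn hV (by positivity) hdiv
  refine ⟨m, hm.congr' ?_⟩
  filter_upwards [eventually_gt_atTop (r₀ + 2)] with r hr
  rw [flux_eq_sphereIntegral V (by linarith)]
  refine sphereIntegral_congr (by linarith) fun x hx => ?_
  rw [massIntegrand_eq]
  exact Finset.sum_congr rfl fun j _ => by rw [hVf j x (by linarith)]

/-! ### Comparison with the ADM mass -/

lemma sum_inducedMetric_inv_mul (T : E (n + 1) ≃ᵃⁱ[ℝ] WithLp 2 (E n × ℝ)) {f : E n → ℝ} {x : E n}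
    (hf : DifferentiableAt ℝ f x) (j : Fin n) :
    ∑ k, (inducedMetric (graphMap T f) x)⁻¹ j k * x k =
      x j - pd j f x * (∑ k, pd k f x * x k) / (1 + gradSq f x) := by
  simp only [inducedMetric_graphMap_inv T hf, sub_mul, Finset.sum_sub_distrib]
  rw [Finset.mul_sum, Finset.sum_div]
  congr 1
  · simp
  · exact Finset.sum_congr rfl fun k _ => by ring

lemma sum_inducedMetric_inv_mul_mul (T : E (n + 1) ≃ᵃⁱ[ℝ] WithLp 2 (E n × ℝ)) {f : E n → ℝ}
    {x : E n} (hf : DifferentiableAt ℝ f x) :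
    ∑ k, ∑ l, (inducedMetric (graphMap T f) x)⁻¹ k l * x k * x l =
      ‖x‖ ^ 2 - (∑ k, pd k f x * x k) ^ 2 / (1 + gradSq f x) := by
  have h (k : Fin n) : ∑ l, (inducedMetric (graphMap T f) x)⁻¹ k l * x k * x l =
      x k ^ 2 - (pd k f x * x k) * ((∑ k, pd k f x * x k) / (1 + gradSq f x)) := by
    have : ∑ l, (inducedMetric (graphMap T f) x)⁻¹ k l * x k * x l =
        x k * ∑ l, (inducedMetric (graphMap T f) x)⁻¹ k l * x l := by
      rw [Finset.mul_sum]
      exact Finset.sum_congr rfl fun l _ => by ring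
    rw [this, sum_inducedMetric_inv_mul T hf]
    ring
  simp only [h, Finset.sum_sub_distrib, ← Finset.sum_mul]
  rw [EuclideanSpace.real_norm_sq_eq]
  ring

/-- Parseval on `xᗮ` combined with Pythagoras along `x`. -/
lemma sum_sq_inner_stdOrthonormalBasis_orthogonal (x a : E n) (hx : x ≠ 0) :
    ∑ s, inner ℝ ((stdOrthonormalBasis ℝ (Submodule.span ℝ {x})ᗮ s : E n)) a ^ 2 =
      ‖a‖ ^ 2 - inner ℝ x a ^ 2 / ‖x‖ ^ 2 := by
  have hx' : ‖x‖ ≠ 0 := norm_ne_zero_iff.2 hx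
  set S := Submodule.span ℝ {x}
  have h1 := Submodule.norm_sq_eq_add_norm_sq_projection a S
  have h2 : ‖S.orthogonalProjectionOnto a‖ ^ 2 = inner ℝ x a ^ 2 / ‖x‖ ^ 2 := by
    have : ‖S.orthogonalProjectionOnto a‖ = ‖S.starProjection a‖ := by simp
    rw [this, Submodule.starProjection_singleton, norm_smul, mul_pow]
    simp only [Real.norm_eq_abs, sq_abs, RCLike.ofReal_real_eq_id, id_eq]
    field_simp
  have h3 := (stdOrthonormalBasis ℝ Sᗮ).sum_sq_norm_inner_right (Sᗮ.orthogonalProjectionOnto a)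
  rw [h1, h2, ← h3]
  simp only [Real.norm_eq_abs, sq_abs, add_sub_cancel_left]
  refine Finset.sum_congr rfl fun s _ => ?_
  rw [Submodule.inner_orthogonalProjectionOnto_eq_of_mem_left]

lemma gram_inducedMetric_graphMap (T : E (n + 1) ≃ᵃⁱ[ℝ] WithLp 2 (E n × ℝ)) {f : E n → ℝ}
    {x : E n} (hf : DifferentiableAt ℝ f x) {ι : Type*} [DecidableEq ι] {b : ι → E n}
    (hb : Orthonormal ℝ b) :
    (Matrix.of fun s t => ∑ i, ∑ j, inducedMetric (graphMap T f) x i j * b s i * b t j) =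
      1 + Matrix.vecMulVec (fun s => ∑ i, pd i f x * b s i) (fun s => ∑ i, pd i f x * b s i) := by
  ext s t
  have h1 : ∑ i, b s i * b t i = (1 : Matrix ι ι ℝ) s t := by
    rw [Matrix.one_apply, ← orthonormal_iff_ite.1 hb s t]
    simp only [PiLp.inner_apply, RCLike.inner_apply, conj_trivial, mul_comm]
  rw [Matrix.add_apply, Matrix.vecMulVec_apply, ← h1, Finset.sum_mul_sum,
    ← Finset.sum_add_distrib, Matrix.of_apply]
  refine Finset.sum_congr rfl fun i _ => ?_
  rw [inducedMetric_graphMap T hf]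
  simp only [Matrix.add_apply, Matrix.vecMulVec_apply, add_mul, Finset.sum_add_distrib]
  congr 1
  · simp [Matrix.one_apply]
  · exact Finset.sum_congr rfl fun j _ => by ring

lemma sphereDensity_graphMap (T : E (n + 1) ≃ᵃⁱ[ℝ] WithLp 2 (E n × ℝ)) {f : E n → ℝ}
    {x : E n} (hf : DifferentiableAt ℝ f x) (hx : x ≠ 0) :
    sphereDensity (inducedMetric (graphMap T f)) x =
      Real.sqrt (1 + gradSq f x - (∑ k, pd k f x * x k) ^ 2 / ‖x‖ ^ 2) := by
  let a : E n := WithLp.toLp 2 fun i => pd i f x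
  have hin (v : E n) : ∑ i, pd i f x * v i = inner ℝ v a := by
    simp only [PiLp.inner_apply, RCLike.inner_apply, conj_trivial, a]
  have ha : ‖a‖ ^ 2 = gradSq f x := EuclideanSpace.real_norm_sq_eq a
  have hon : Orthonormal ℝ fun s => (stdOrthonormalBasis ℝ (Submodule.span ℝ {x})ᗮ s : E n) :=
    (stdOrthonormalBasis ℝ (Submodule.span ℝ {x})ᗮ).orthonormal.comp_linearIsometry
      (Submodule.span ℝ {x})ᗮ.subtypeₗᵢ
  unfold sphereDensity
  simp only
  rw [gram_inducedMetric_graphMap T hf hon, det_one_add_vecMulVec_self]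
  simp only [hin]
  rw [sum_sq_inner_stdOrthonormalBasis_orthogonal x a hx, ha, add_sub_assoc]

/-! ### The error between the two integrands and its decay -/

/-- The difference of the integrands of the ADM mass and of the graphical mass. -/
def massDefect (f : E n → ℝ) (x : E n) : ℝ :=
  ∑ i, ∑ j, (pd i (pd i f) x * pd j f x - pd i (pd j f) x * pd i f x) *
    ((Real.sqrt (1 + gradSq f x) - 1 / (1 + gradSq f x)) * (x j / ‖x‖) -
      pd j f x * ((∑ k, pd k f x * x k) / ‖x‖) / Real.sqrt (1 + gradSq f x))

lemma sq_sum_pd_mul_le (f : E n → ℝ) (x : E n) :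
    (∑ k, pd k f x * x k) ^ 2 ≤ gradSq f x * ‖x‖ ^ 2 := by
  rw [EuclideanSpace.real_norm_sq_eq]
  exact Finset.sum_mul_sq_le_sq_mul_sq _ _ _

/-- With `s = ⟨Df, x⟩`, the `g⁻¹`-length of `x` is `‖x‖ √(W - s²/‖x‖²) / √W`. Its middle factor is
exactly the sphere density, so it cancels in the product. -/
lemma unitNormal_mul_sphereDensity (T : E (n + 1) ≃ᵃⁱ[ℝ] WithLp 2 (E n × ℝ)) {f : E n → ℝ}
    {x : E n} (hf : DifferentiableAt ℝ f x) (hx : x ≠ 0) (j : Fin n) :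
    unitNormal (inducedMetric (graphMap T f)) x j *
        sphereDensity (inducedMetric (graphMap T f)) x =
      Real.sqrt (1 + gradSq f x) * (x j / ‖x‖) -
        pd j f x * ((∑ k, pd k f x * x k) / ‖x‖) / Real.sqrt (1 + gradSq f x) := by
  have hx' : 0 < ‖x‖ := norm_pos_iff.2 hx
  have hW := one_add_gradSq_pos f x
  rw [unitNormal, sphereDensity_graphMap T hf hx, sum_inducedMetric_inv_mul T hf,
    sum_inducedMetric_inv_mul_mul T hf]
  have hs := sq_sum_pd_mul_le f x
  set s := ∑ k, pd k f x * x k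
  set W := 1 + gradSq f x with hWdef
  -- Cauchy–Schwarz bounds `s²/‖x‖²` by `|Df|² = W - 1`.
  have hD : 0 < W - s ^ 2 / ‖x‖ ^ 2 := by
    have : s ^ 2 / ‖x‖ ^ 2 ≤ gradSq f x := by
      rw [div_le_iff₀ (by positivity)]
      exact hs
    linarith
  have h1 : ‖x‖ ^ 2 - s ^ 2 / W = (‖x‖ ^ 2 * (W - s ^ 2 / ‖x‖ ^ 2)) / W := by
    field_simp
  rw [h1, Real.sqrt_div (by positivity), Real.sqrt_mul (by positivity), Real.sqrt_sq hx'.le]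
  have hsD := Real.sqrt_pos.2 hD
  have hsW := Real.sqrt_pos.2 hW
  have hWs : W = Real.sqrt W ^ 2 := (Real.sq_sqrt hW.le).symm
  generalize Real.sqrt (W - s ^ 2 / ‖x‖ ^ 2) = d at hsD
  generalize Real.sqrt W = w at hWs hsW
  rw [hWs]
  field_simp

lemma admIntegrand_graphMap (T : E (n + 1) ≃ᵃⁱ[ℝ] WithLp 2 (E n × ℝ)) {f : E n → ℝ}
    {x : E n} (hf : ContDiffAt ℝ 2 f x) (hx : x ≠ 0) :
    admIntegrand (inducedMetric (graphMap T f)) x = massIntegrand f x + massDefect f x := by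
  rw [admIntegrand, massIntegrand, massDefect, Finset.sum_mul, Finset.mul_sum,
    ← Finset.sum_add_distrib]
  refine Finset.sum_congr rfl fun i _ => ?_
  rw [Finset.sum_mul, Finset.mul_sum, ← Finset.sum_add_distrib]
  refine Finset.sum_congr rfl fun j _ => ?_
  rw [mul_assoc, unitNormal_mul_sphereDensity T (hf.differentiableAt (by norm_num)) hx,
    pd_inducedMetric_graphMap T hf, pd_inducedMetric_graphMap T hf, pd_comm hf j i]
  ring

lemma abs_pd_le (f : E n → ℝ) (x : E n) (i : Fin n) : |pd i f x| ≤ Real.sqrt (gradSq f x) :=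
  Real.abs_le_sqrt (Finset.single_le_sum (f := fun i => pd i f x ^ 2)
    (fun _ _ => sq_nonneg _) (Finset.mem_univ i))

lemma abs_pd_pd_le (f : E n → ℝ) (x : E n) (i j : Fin n) : |pd i (pd j f) x| ≤ hessNorm f x := by
  refine Real.abs_le_sqrt ((Finset.single_le_sum (f := fun j => pd i (pd j f) x ^ 2)
    (fun _ _ => sq_nonneg _) (Finset.mem_univ j)).trans ?_)
  exact Finset.single_le_sum (f := fun i => ∑ j, pd i (pd j f) x ^ 2)
    (fun _ _ => Finset.sum_nonneg fun _ _ => sq_nonneg _) (Finset.mem_univ i)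

/-- Each of the `n²` terms is a second-order factor, at most `2 |D²f| |Df|`, times a weight, at most
`3 |Df|²`: `2 |Df|²` from `√W - 1/W` and `|Df|²` from the normal correction. -/
lemma abs_massDefect_le (f : E n → ℝ) (x : E n) :
    |massDefect f x| ≤ 6 * n ^ 2 * (Real.sqrt (gradSq f x) * (gradSq f x * hessNorm f x)) := by
  have hG : 0 ≤ gradSq f x := Finset.sum_nonneg fun i _ => sq_nonneg _
  have hh : 0 ≤ hessNorm f x := Real.sqrt_nonneg _
  have hGs := Real.sq_sqrt hG
  have hx1 (j : Fin n) : |x j / ‖x‖| ≤ 1 := by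
    rw [abs_div, abs_norm]
    exact div_le_one_of_le₀ (PiLp.norm_apply_le x j) (norm_nonneg _)
  have hs : |(∑ k, pd k f x * x k) / ‖x‖| ≤ Real.sqrt (gradSq f x) := by
    rw [abs_div, abs_norm]
    refine div_le_of_le_mul₀ (norm_nonneg _) (Real.sqrt_nonneg _) ?_
    refine abs_le_of_sq_le_sq ?_ (by positivity)
    rw [mul_pow, hGs]
    exact sq_sum_pd_mul_le f x
  have hW : 1 ≤ Real.sqrt (1 + gradSq f x) := Real.one_le_sqrt.2 (by linarith)
  have hW1 : |Real.sqrt (1 + gradSq f x) - 1 / (1 + gradSq f x)| ≤ 2 * gradSq f x := by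
    have h1 : Real.sqrt (1 + gradSq f x) ≤ 1 + gradSq f x :=
      Real.sqrt_le_self_iff.2 (Or.inr (by linarith))
    have h2 : 1 / (1 + gradSq f x) ≤ 1 := div_le_one_of_le₀ (by linarith) (by linarith)
    have h3 : 1 - gradSq f x ≤ 1 / (1 + gradSq f x) := by
      rw [le_div_iff₀ (by linarith)]
      nlinarith
    rw [abs_le]
    constructor <;> linarith
  set G := gradSq f x
  set h := hessNorm f x
  have hterm (i j : Fin n) : |(pd i (pd i f) x * pd j f x - pd i (pd j f) x * pd i f x) *
      ((Real.sqrt (1 + G) - 1 / (1 + G)) * (x j / ‖x‖) -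
        pd j f x * ((∑ k, pd k f x * x k) / ‖x‖) / Real.sqrt (1 + G))| ≤
      (2 * (h * Real.sqrt G)) * (3 * G) := by
    rw [abs_mul]
    gcongr
    · refine (abs_sub _ _).trans ?_
      rw [abs_mul, abs_mul, two_mul]
      gcongr
      exacts [abs_pd_pd_le f x i i, abs_pd_le f x j, abs_pd_pd_le f x i j, abs_pd_le f x i]
    · refine (abs_sub _ _).trans ?_
      rw [abs_mul (_ - _), abs_div (_ * _), abs_mul (pd j f x),
        abs_of_pos (zero_lt_one.trans_le hW)]
      have h1 : |Real.sqrt (1 + G) - 1 / (1 + G)| * |x j / ‖x‖| ≤ 2 * G * 1 :=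
        mul_le_mul hW1 (hx1 j) (abs_nonneg _) (by positivity)
      have h2 : |pd j f x| * |(∑ k, pd k f x * x k) / ‖x‖| ≤ Real.sqrt G * Real.sqrt G :=
        mul_le_mul (abs_pd_le f x j) hs (abs_nonneg _) (Real.sqrt_nonneg _)
      have h3 := (div_le_self (by positivity) hW).trans h2
      rw [← sq, hGs] at h3
      linarith
  calc |massDefect f x| ≤ ∑ _i : Fin n, ∑ _j : Fin n, (2 * (h * Real.sqrt G)) * (3 * G) :=
        (Finset.abs_sum_le_sum_abs _ _).trans (Finset.sum_le_sum fun i _ =>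
          (Finset.abs_sum_le_sum_abs _ _).trans (Finset.sum_le_sum fun j _ => hterm i j))
    _ = _ := by
        simp
        ring

lemma tendsto_sphereIntegral_of_isLittleO (hn : n ≠ 0) {g : E n → ℝ}
    (hg : g =o[cobounded (E n)] fun x => ‖x‖ ^ (1 - (n : ℝ))) :
    Tendsto (fun r => sphereIntegral r g) atTop (𝓝 0) := by
  have hv : 0 ≤ sphereVolume n := measureReal_nonneg
  rw [Metric.tendsto_atTop]
  intro ε hε
  -- The `+ 1` keeps the denominator positive and makes the final bound strictly less than `ε`.
  have h1 := hg.def (c := ε / (sphereVolume n + 1)) (by positivity)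
  rw [← comap_norm_atTop, eventually_comap] at h1
  obtain ⟨r₀, hr₀⟩ := eventually_atTop.1 h1
  refine ⟨max r₀ 1, fun r hr => ?_⟩
  have hr1 : 0 < r := zero_lt_one.trans_le (le_of_max_le_right hr)
  rw [dist_zero_right, Real.norm_eq_abs]
  refine (abs_sphereIntegral_le (C := ε / (sphereVolume n + 1) * r ^ (1 - (n : ℝ))) hr1.le
    fun x hx => ?_).trans_lt ?_
  · have := hr₀ r (le_of_max_le_left hr) x hx
    rwa [Real.norm_eq_abs, Real.norm_eq_abs, hx, abs_of_nonneg (Real.rpow_nonneg hr1.le _)] at this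
  · have h2 : r ^ (n - 1) * r ^ (1 - (n : ℝ)) = 1 := by
      rw [← Real.rpow_natCast, ← Real.rpow_add hr1, Nat.cast_sub (Nat.one_le_iff_ne_zero.2 hn)]
      simp
    calc r ^ (n - 1) * (ε / (sphereVolume n + 1) * r ^ (1 - (n : ℝ)) * sphereVolume n)
        = (r ^ (n - 1) * r ^ (1 - (n : ℝ))) * (ε / (sphereVolume n + 1) * sphereVolume n) := by ring
      _ = ε * (sphereVolume n / (sphereVolume n + 1)) := by rw [h2]; ring
      _ < ε * 1 := by
          gcongr
          rw [div_lt_one (by positivity)]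
          linarith
      _ = ε := mul_one ε

lemma sphereIntegral_add {g h : E n → ℝ} {r : ℝ} (hr : 0 ≤ r)
    (hg : ContinuousOn g (Metric.sphere 0 r)) (hh : ContinuousOn h (Metric.sphere 0 r)) :
    sphereIntegral r (fun x => g x + h x) = sphereIntegral r g + sphereIntegral r h := by
  have hint {u : E n → ℝ} (hu : ContinuousOn u (Metric.sphere 0 r)) :
      Integrable (fun ω : Metric.sphere (0 : E n) 1 => u (r • (ω : E n)))
        (volume : Measure (E n)).toSphere :=
    (hu.comp_continuous (by fun_prop)
      fun ω => by simp [norm_smul, abs_of_nonneg hr]).integrable_of_hasCompactSupport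
        (HasCompactSupport.of_compactSpace _)
  unfold sphereIntegral
  rw [integral_add (hint hg) (hint hh), mul_add]

lemma continuousAt_massDefect {f : E n → ℝ} {x : E n} (hf : ContDiffAt ℝ 2 f x) (hx : x ≠ 0) :
    ContinuousAt (massDefect f) x := by
  have hx' : ‖x‖ ≠ 0 := norm_ne_zero_iff.2 hx
  have h1 (k : Fin n) : ContDiffAt ℝ 1 (pd k f) x := ContDiffAt.pd (k := 1) hf k
  have h2 (k : Fin n) : ContinuousAt (pd k f) x := (h1 k).continuousAt
  have h3 (k l : Fin n) : ContinuousAt (pd k (pd l f)) x :=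
    (ContDiffAt.pd (k := 0) (h1 l) k).continuousAt
  have hW := one_add_gradSq_pos f x
  have h4 : ContinuousAt (gradSq f) x := by
    unfold gradSq
    fun_prop
  have h5 (j : Fin n) : ContinuousAt (fun x : E n => x j) x := by fun_prop
  have hsW : Real.sqrt (1 + gradSq f x) ≠ 0 := (Real.sqrt_pos.2 hW).ne'
  unfold massDefect
  fun_prop (disch := first | assumption | exact hW.ne')

end HypersurfaceMass

end

/-! ### Finiteness of the mass and comparison with the ADM mass -/

open HypersurfaceMass
theorem mainTheorem12 (n : ℕ) (hn : 2 ≤ n)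
    (M K : Set (E (n + 1))) (hM : IsHypersurfaceOfRegularEnds 3 M K)
    (N : Set (E (n + 1))) (hN : N ∈ ends M K)
    (T : E (n + 1) ≃ᵃⁱ[ℝ] WithLp 2 (E n × ℝ)) (Ω : Set (E n)) (f : E n → ℝ)
    (hf : IsRegularEnd N T Ω f)
    (hR : IntegrableOn (scalarCurvature (inducedMetric (graphMap T f))) Ωᶜ
      (riemannianVolume (inducedMetric (graphMap T f))))
    (hdiff : ∀ᶠ x in cobounded (E n), DifferentiableAt ℝ f x)
    (hDf : (fun x => Real.sqrt (gradSq f x)) =O[cobounded (E n)] fun _ => (1 : ℝ)) :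
    (∃ m : ℝ, HasGraphicalMass f m) ∧
    (3 ≤ n → ∀ q : ℝ, ((n : ℝ) - 2) / 2 < q →
      IsBigOTwo (gradSq f) q →
      (fun x => gradSq f x * hessNorm f x) =o[cobounded (E n)] (fun x => ‖x‖ ^ (1 - (n : ℝ))) →
      ∃ m : ℝ, HasGraphicalMass f m ∧ HasADMMass (inducedMetric (graphMap T f)) m) := by
  have hn0 : n ≠ 0 := by omega
  obtain ⟨r₀, h0, hr₀⟩ := hf.exists_contDiffAt (by norm_num) hM.embedded hN hdiff
  have hC3 (x : E n) (hx : r₀ < ‖x‖) : ContDiffAt ℝ 3 f x := (hr₀ x hx).2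
  obtain ⟨m, hm⟩ := exists_tendsto_sphereIntegral_massIntegrand hn0 T h0 hC3
    (hR.mono_set fun x hx => (hr₀ x hx).1)
  refine ⟨⟨_, hm.const_mul _⟩, fun _ q _ _ ho => ⟨_, hm.const_mul _, ?_⟩⟩
  -- One factor `|Df|` is bounded by `hDf`; the remaining `|Df|²|D²f|` is `o(|x|^{1-n})` by `ho`.
  have hdef : massDefect f =o[cobounded (E n)] fun x => ‖x‖ ^ (1 - (n : ℝ)) := by
    refine IsBigO.trans_isLittleO (IsBigO.of_bound (6 * (n : ℝ) ^ 2) (.of_forall fun x => ?_))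
      (by simpa using hDf.mul_isLittleO ho)
    exact (abs_massDefect_le f x).trans (by gcongr; exact le_abs_self _)
  have hsum := hm.add (tendsto_sphereIntegral_of_isLittleO hn0 hdef)
  rw [add_zero] at hsum
  refine (hsum.const_mul _).congr' ?_
  filter_upwards [eventually_gt_atTop r₀] with r hr
  have hr0 : 0 < r := h0.trans hr
  have hsph {x : E n} (hx : ‖x‖ = r) : x ≠ 0 ∧ ContDiffAt ℝ 3 f x :=
    ⟨norm_ne_zero_iff.1 (hx ▸ hr0.ne'), hC3 x (hx ▸ hr)⟩
  -- On `S_r` with `r > r₀` the ADM integrand splits pointwise; continuity of both pieces makes the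
  -- integral additive.
  rw [sphereIntegral_congr hr0.le fun x hx =>
    admIntegrand_graphMap T ((hsph hx).2.of_le (by norm_num)) (hsph hx).1,
    sphereIntegral_add hr0.le]
  · intro x hx
    rw [mem_sphere_zero_iff_norm] at hx
    have : ContinuousAt (massIntegrand f) x := by
      have hx' : ‖x‖ ≠ 0 := norm_ne_zero_iff.2 (hsph hx).1
      rw [funext (massIntegrand_eq f)]
      have (j : Fin n) : ContinuousAt (massField f j) x :=
        (contDiffAt_massField (hsph hx).2 j).continuousAt
      have h5 (j : Fin n) : ContinuousAt (fun x : E n => x j) x := by fun_prop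
      fun_prop (disch := assumption)
    exact this.continuousWithinAt
  · intro x hx
    rw [mem_sphere_zero_iff_norm] at hx
    exact (continuousAt_massDefect ((hsph hx).2.of_le (by norm_num))
      (hsph hx).1).continuousWithinAt
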